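/- **Setting.** Let $n\ge 1$, let $\mu$ be Lebesgue measure on $\mathbb R^n$ and $\operatorname{ci}(A)=\overline{\operatorname{int}A}$. Let $\mathfrak J_n$ be the collection of bounded sets $A\subset\mathbb R^n$ with $A=\operatorname{ci}(A)$ and $\mu(\partial A)=0$ (so $\emptyset\in\mathfrak J_n$). For Lebesgue measurable sets of finite measure put $d_\mu(A,B)=\mu(A\,\Delta\,B)$. **Measure average.** Fix constants $N\ge 1$ and $\varepsilon>0$. Let $d_S(p,A)$ be $d(p,\partial A)$ for $p\in A$ and $-d(p,\partial A)$ for $p\notin A$. For $B\subsetneq A$ and $x\in\mathbb R$ put $f_{A,B,x}(p)=x\,d_S(p,A)+(1-x)\,d_S(p,B)$, where for $B=\emptyset$ the value $d_S(p,B)$ is replaced by $-\|p-q_A\|$ with a fixed chosen point $q_A\in A$ maximizing $d_S(\cdot,A)$ over $A$. Let $h(x)=\mu(\{f_{A,B,x}\ge0\})$. For $t\in[0,1]$ define $S_t(A,B)$ as follows. - If $\mu(\{f_{A,B,1/2}=0\})=0$, then $S_t(A,B)=\operatorname{ci}(\{f_{A,B,g}\ge 0\})$, where $g$ is any minimizer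 of $|h(\xi)-(t\mu(A)+(1-t)\mu(B))|$ over $\xi\in[-N,N]$. - Otherwise $S_t(A,B)=\operatorname{ci}(\{p\in A: d(p,B)\le r\})$, where $r\ge0$ is any number with $\mu(\{p\in A: d(p,B)\le r\})=t\mu(A)+(1-t)\mu(B)$. For $A,B\in\mathfrak J_n$ with $B\subsetneq A$ define $tA\bigoplus(1-t)B=\bigcup_C S_t(B\cup C,B)$, where $C$ runs over the connected components of $A\setminus B$ if there are finitely many; otherwise $C$ runs over the components of measure $\ge\varepsilon$ and, as one further piece, the union of all components of measure $<\varepsilon$. Put $tA\bigoplus(1-t)A=A$. For general $A,B\in\mathfrak J_n$ and $t\in[0,1]$, with $K=\operatorname{ci}(A\cap B)$, define $$tA\bigoplus(1-t)B=\Big(tA\bigoplus(1-t)K\Big)\cup\Big((1-t)B\bigoplus tK\Big).$$ **Set-valued spline subdivision of degree $m\ge1$.** Given $F_i^0\in\mathfrak J_n$ $(i\in\mathbb Z)$, define for $k\ge 0$ $$F^{k+1,0}_{2i}=F^k_i,\qquad F^{k+1,0}_{2i+1}=\tfrac12F^k_i\bigoplus\tfrac12F^k_{i+1},$$ $$F_i^{k+1,j}=\tfrac12F_i^{k+1,j-1}\bigoplus\tfrac12F_{i+1}^{k+1,j-1}\quad(1\le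 j\le m-1),\qquad F_i^{k+1}=F^{k+1,m-1}_{i-\lfloor (m-1)/2\rfloor}.$$ For $i2^{-k}\le x<(i+1)2^{-k}$ let $F_k(x)=\lambda F_i^k\bigoplus(1-\lambda)F_{i+1}^k$ with $\lambda=(i+1)-x2^k$. A limit $F^\infty$ assigns to each $x\in\mathbb R$ a Lebesgue measurable set $F^\infty(x)$ of finite measure with $d_\mu(F_k(x),F^\infty(x))\to0$; it is determined up to null sets. **Real-valued spline subdivision of degree $m$.** Let $f_i^0=\mu(F_i^0)$ and $f_i^{k+1}=\sum_{j\in\mathbb Z}a^{(m)}_{\lceil (m+1)/2\rceil+i-2j}f_j^k$, where $a_l^{(m)}=2^{-m}\binom{m+1}{l}$ for $0\le l\le m+1$ and $a_l^{(m)}=0$ otherwise. Let $f_k(x)=\lambda f_i^k+(1-\lambda)f_{i+1}^k$ for $i,\lambda$ as above, and $f^\infty(x)=\lim_{k\to\infty}f_k(x)$. **Speed.** For a set-valued $F$ and a real-valued $f$ put $$v_F(x)=\lim_{\delta\to0}\frac{d_\mu(F(x),F(x+\delta))}{|\delta|},\qquad v_f(x)=\lim_{\delta\to0}\frac{|f(x)-f(x+\delta)|}{|\delta|},$$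 whenever the limit exists. **Statement.** Let $m\ge1$ and let $\{F_i^0\}_{i\in\mathbb Z}\subset\mathfrak J_n$ be monotone, that is, $F^0_i\subseteq F^0_{i+1}$ for all $i$, or $F^0_i\supseteq F^0_{i+1}$ for all $i$. Then the limits $F^\infty$ and $f^\infty$ exist, and for every $x\in\mathbb R$ $$v_{F^\infty}(x)=v_{f^\infty}(x),$$ in the sense that one of the two speeds exists if and only if the other does, and then they are equal. In particular, wherever $f^\infty$ is differentiable, $v_{F^\infty}(x)$ exists and equals $|(f^\infty)'(x)|$. -/

import Mathlib

open MeasureTheory Set Filter Topology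

noncomputable section

/-- `ci(A)`: the closure of the interior of `A`. -/
def closInt {n : ℕ} (A : Set (EuclideanSpace ℝ (Fin n))) : Set (EuclideanSpace ℝ (Fin n)) :=
  closure (interior A)

/-- Membership in `𝔍ₙ`: regular compact (bounded with `A = ci(A)`) and Jordan measurable
(the boundary has Lebesgue measure zero). The empty set belongs to `𝔍ₙ`. -/
def IsRegularJordan {n : ℕ} (A : Set (EuclideanSpace ℝ (Fin n))) : Prop :=
  Bornology.IsBounded A ∧ closInt A = A ∧ volume (frontier A) = 0

/-- `d_μ(A, B) = μ(A Δ B)`, for sets of finite measure. -/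
def symmDiffDist {n : ℕ} (A B : Set (EuclideanSpace ℝ (Fin n))) : ℝ :=
  volume.real (symmDiff A B)

/-! ### The distance average -/

open Classical in
/-- The signed distance `d_S(p, A)`: the distance to the boundary of `A`, counted positively on `A`
and negatively off `A`. -/
def sgnDist {n : ℕ} (p : EuclideanSpace ℝ (Fin n)) (A : Set (EuclideanSpace ℝ (Fin n))) : ℝ :=
  if p ∈ A then Metric.infDist p (frontier A) else -Metric.infDist p (frontier A)

/-- `p` is a center of `A`: a point of `A` at which `d_S(·, A)` attains its supremum over `A`. -/
def IsCenter {n : ℕ} (A : Set (EuclideanSpace ℝ (Fin n))) (p : EuclideanSpace ℝ (Fin n)) : Prop :=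
  p ∈ A ∧ ∀ a ∈ A, sgnDist a A ≤ sgnDist p A

/-- `q` chooses a center of every set that has one. -/
def IsCenterChoice {n : ℕ} (q : Set (EuclideanSpace ℝ (Fin n)) → EuclideanSpace ℝ (Fin n)) :
    Prop :=
  ∀ A, (∃ p, IsCenter A p) → IsCenter A (q A)

open Classical in
/-- The signed distance to `B` in an average of `B` with the set `A`. If `B` is empty, it is
replaced by minus the distance to the chosen center of `A`. -/
def sgnDistRel {n : ℕ} (q : Set (EuclideanSpace ℝ (Fin n)) → EuclideanSpace ℝ (Fin n))
    (A B : Set (EuclideanSpace ℝ (Fin n))) (p : EuclideanSpace ℝ (Fin n)) : ℝ :=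
  if B = ∅ then -dist p (q A) else sgnDist p B

/-- `f_{A,B,x}(p) = x d_S(p, A) + (1 - x) d_S(p, B)`. -/
def avgFun {n : ℕ} (q : Set (EuclideanSpace ℝ (Fin n)) → EuclideanSpace ℝ (Fin n))
    (A B : Set (EuclideanSpace ℝ (Fin n))) (x : ℝ) (p : EuclideanSpace ℝ (Fin n)) : ℝ :=
  x * sgnDistRel q B A p + (1 - x) * sgnDistRel q A B p

open Classical in
/-- The distance average of `A` and `B` with parameter `x ∈ ℝ`: the set `{f_{A,B,x} ≥ 0}`; the
average of two empty sets is empty. -/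
def distAverage {n : ℕ} (q : Set (EuclideanSpace ℝ (Fin n)) → EuclideanSpace ℝ (Fin n))
    (x : ℝ) (A B : Set (EuclideanSpace ℝ (Fin n))) : Set (EuclideanSpace ℝ (Fin n)) :=
  if A = ∅ ∧ B = ∅ then ∅ else {p | 0 ≤ avgFun q A B x p}

/-- The zero-measure condition: the level set `{f_{A,B,1/2} = 0}` is a null set. -/
def ZeroMeasureCondition {n : ℕ}
    (q : Set (EuclideanSpace ℝ (Fin n)) → EuclideanSpace ℝ (Fin n))
    (A B : Set (EuclideanSpace ℝ (Fin n))) : Prop :=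
  volume {p | avgFun q A B (1 / 2) p = 0} = 0

/-! ### The measure average `tA ⊕ (1 - t)B` for `t ∈ [0, 1]` -/

/-- `t μ(A) + (1 - t) μ(B)`. -/
def targetMeasure {n : ℕ} (t : ℝ) (A B : Set (EuclideanSpace ℝ (Fin n))) : ℝ :=
  t * volume.real A + (1 - t) * volume.real B

/-- `x ∈ [-N, N]` minimizes `|h(ξ) - (t μ(A) + (1 - t) μ(B))|` over `ξ ∈ [-N, N]`, where `h(ξ)` is
the measure of the distance average with parameter `ξ`. -/
def IsReparam {n : ℕ} (N : ℝ)
    (q : Set (EuclideanSpace ℝ (Fin n)) → EuclideanSpace ℝ (Fin n))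
    (t : ℝ) (A B : Set (EuclideanSpace ℝ (Fin n))) (x : ℝ) : Prop :=
  x ∈ Icc (-N) N ∧
    IsMinOn (fun ξ : ℝ => |volume.real (distAverage q ξ A B) - targetMeasure t A B|)
      (Icc (-N) N) x

/-- `r ≥ 0` is a radius for which the part in `A` of the `r`-offset `{p : d(p, B) ≤ r}` of `B`
has measure `t μ(A) + (1 - t) μ(B)`. -/
def IsOffsetRadius {n : ℕ} (t : ℝ) (A B : Set (EuclideanSpace ℝ (Fin n))) (r : ℝ) : Prop :=
  0 ≤ r ∧ volume.real (Metric.cthickening r B ∩ A) = targetMeasure t A B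

open Classical in
/-- The measure average, for `t ∈ [0, 1]`, of `A` and `B` with `B ⊂ A` when `A \ B` is treated as
one component. Under the zero-measure condition it is the reparametrized distance average, otherwise
the part in `A` of an offset of `B`. `Classical.epsilon` picks any admissible parameter. -/
def simpleAverage {n : ℕ} (N : ℝ)
    (q : Set (EuclideanSpace ℝ (Fin n)) → EuclideanSpace ℝ (Fin n))
    (t : ℝ) (A B : Set (EuclideanSpace ℝ (Fin n))) : Set (EuclideanSpace ℝ (Fin n)) :=
  if ZeroMeasureCondition q A B then
    closInt (distAverage q (Classical.epsilon (IsReparam N q t A B)) A B)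
  else
    closInt (Metric.cthickening (Classical.epsilon (IsOffsetRadius t A B)) B ∩ A)

/-- The collection of connected components of `D`. -/
def componentsOf {n : ℕ} (D : Set (EuclideanSpace ℝ (Fin n))) :
    Set (Set (EuclideanSpace ℝ (Fin n))) :=
  {C | ∃ x ∈ D, C = connectedComponentIn D x}

open Classical in
/-- The pieces into which `D = A \ B` is decomposed: its connected components if there are finitely
many of them; otherwise the components of measure at least `ε` together with the union of all
components of measure less than `ε`, which counts as a single component. -/
def piecesOf {n : ℕ} (ε : ℝ) (D : Set (EuclideanSpace ℝ (Fin n))) :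
    Set (Set (EuclideanSpace ℝ (Fin n))) :=
  if (componentsOf D).Finite then componentsOf D
  else insert (⋃₀ {C ∈ componentsOf D | volume.real C < ε})
    {C ∈ componentsOf D | ε ≤ volume.real C}

open Classical in
/-- The measure average of nested sets `B ⊆ A`, for `t ∈ [0, 1]`. -/
def nestedAverage {n : ℕ} (N ε : ℝ)
    (q : Set (EuclideanSpace ℝ (Fin n)) → EuclideanSpace ℝ (Fin n))
    (t : ℝ) (A B : Set (EuclideanSpace ℝ (Fin n))) : Set (EuclideanSpace ℝ (Fin n)) :=
  if A = B then A else ⋃ C ∈ piecesOf ε (A \ B), simpleAverage N q t (B ∪ C) B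

/-- The measure average `tA ⊕ (1 - t)B` of general sets, for `t ∈ [0, 1]`: the union of
`tA ⊕ (1 - t) ci(A ∩ B)` and `(1 - t)B ⊕ t ci(A ∩ B)`. -/
def measureAverage {n : ℕ} (N ε : ℝ)
    (q : Set (EuclideanSpace ℝ (Fin n)) → EuclideanSpace ℝ (Fin n))
    (t : ℝ) (A B : Set (EuclideanSpace ℝ (Fin n))) : Set (EuclideanSpace ℝ (Fin n)) :=
  nestedAverage N ε q t A (closInt (A ∩ B)) ∪ nestedAverage N ε q (1 - t) B (closInt (A ∩ B))

/-! ### Set-valued spline subdivision, by the Lane-Riesenfeld algorithm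

Here `avg t a b` stands for the average of `a` with weight `t` and `b` with weight `1 - t`. -/

/-- Doubling combined with the first averaging step: `F_{2i} = F_i` and
`F_{2i+1} = avg (1/2) F_i F_{i+1}`. -/
def doublingStep {X : Type*} (avg : ℝ → X → X → X) (F : ℤ → X) (i : ℤ) : X :=
  if Even i then F (i / 2) else avg (1 / 2) (F (i / 2)) (F (i / 2 + 1))

/-- Averages of consecutive elements. -/
def averagingStep {X : Type*} (avg : ℝ → X → X → X) (F : ℤ → X) (i : ℤ) : X :=
  avg (1 / 2) (F i) (F (i + 1))

/-- One refinement step of degree `m ≥ 1`: doubling, `m - 1` averaging steps, and the shift by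
`⌊(m - 1) / 2⌋`. -/
def refineStep {X : Type*} (avg : ℝ → X → X → X) (m : ℕ) (F : ℤ → X) (i : ℤ) : X :=
  ((averagingStep avg)^[m - 1] (doublingStep avg F)) (i - (((m - 1) / 2 : ℕ) : ℤ))

/-- The piecewise interpolant at level `k`: on `[i 2⁻ᵏ, (i + 1) 2⁻ᵏ]` it is the average of `F_i`
with weight `λ(x) = (i + 1) - x 2ᵏ` and `F_{i+1}` with weight `1 - λ(x)`. -/
def interpolant {X : Type*} (avg : ℝ → X → X → X) (k : ℕ) (F : ℤ → X) (x : ℝ) : X :=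
  avg ((⌊x * 2 ^ k⌋ : ℝ) + 1 - x * 2 ^ k) (F ⌊x * 2 ^ k⌋) (F (⌊x * 2 ^ k⌋ + 1))

/-- `F` is the limit set-valued function of the spline subdivision scheme of degree `m` based on the
measure average and applied to `F₀`: its values are Lebesgue measurable sets of finite measure, and
the interpolants `F_k(x)` converge to `F(x)` in `d_μ`. -/
def IsSetSplineLimit {n : ℕ} (N ε : ℝ)
    (q : Set (EuclideanSpace ℝ (Fin n)) → EuclideanSpace ℝ (Fin n))
    (m : ℕ) (F₀ : ℤ → Set (EuclideanSpace ℝ (Fin n)))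
    (F : ℝ → Set (EuclideanSpace ℝ (Fin n))) : Prop :=
  ∀ x, NullMeasurableSet (F x) volume ∧ volume (F x) < ⊤ ∧
    Tendsto (fun k : ℕ => symmDiffDist
      (interpolant (measureAverage N ε q) k ((refineStep (measureAverage N ε q) m)^[k] F₀) x)
      (F x)) atTop (𝓝 0)

/-! ### Real-valued spline subdivision -/

/-- `a_l^{(m)} = binom(m + 1, l) / 2^m` for `l = 0, …, m + 1`, and `0` for all other `l`. -/
def splineMask (m : ℕ) (l : ℤ) : ℝ :=
  if 0 ≤ l ∧ l ≤ m + 1 then ((m + 1).choose l.toNat : ℝ) / 2 ^ m else 0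

/-- The refinement rule `f_i ↦ ∑_j a^{(m)}_{⌈(m+1)/2⌉ + i - 2j} f_j`, a sum with finitely many
nonzero terms. -/
def realRefine (m : ℕ) (f : ℤ → ℝ) (i : ℤ) : ℝ :=
  ∑ᶠ j : ℤ, splineMask m (⌈((m : ℝ) + 1) / 2⌉ + i - 2 * j) * f j

/-- `f` is the limit function of the real-valued spline subdivision scheme of degree `m` applied to
`f₀`: the piecewise linear interpolants converge to `f`. -/
def IsRealSplineLimit (m : ℕ) (f₀ : ℤ → ℝ) (f : ℝ → ℝ) : Prop :=
  ∀ x, Tendsto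
    (fun k : ℕ => interpolant (fun t a b : ℝ => t * a + (1 - t) * b) k ((realRefine m)^[k] f₀) x)
    atTop (𝓝 (f x))

/-! ### Speed of a curve -/

/-- The speed at `x` of the curve `γ`, with respect to the distance `d`, exists and equals `v`:
`d(γ(x), γ(x + δ)) / |δ| → v` as `δ → 0`, `δ ≠ 0`. -/
def HasSpeedAt {X : Type*} (d : X → X → ℝ) (γ : ℝ → X) (x v : ℝ) : Prop :=
  Tendsto (fun δ : ℝ => d (γ x) (γ (x + δ)) / |δ|) (𝓝[≠] 0) (𝓝 v)

end

/-! On nested sets of finite measure, `d_μ` is the absolute difference of the measures. So if every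
average involved is nested between its arguments and its measure is exactly the prescribed affine
combination, then `μ` carries the set-valued scheme to the linear scheme on `μ(F_i^0)`, and it does
so isometrically. In the limit `d_μ(F^∞(x), F^∞(y)) = |f^∞(x) - f^∞(y)|`, and the two difference
quotients defining the speeds are the same function of `δ`.

The measure-theoretic work is `measureAverage_spec`: for nested arguments the average is again a
regular Jordan set, lies between them, and has the target measure. One piece of `A \ B` is handled
by continuity of the measure and the intermediate value theorem. This requires level sets to be
null, which holds because the function grows linearly along some direction at each of their points,
contrary to Lebesgue density (`measure_zeroSet_of_linear_growth`); only the weight `1/2` needs the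
zero-measure condition as a hypothesis. Different pieces overlap outside `B` only in null frontiers,
so their measures add.

The rest is abstract (`IsChainAverage`). A refined chain stays monotone and is sandwiched by nearby
elements of the previous level. Doubling halves differences of measures and averaging does not
enlarge them, so consecutive interpolants differ by `O(2⁻ᵏ)` and converge. Pascal's rule identifies
the linear Lane-Riesenfeld algorithm with the spline mask. -/

/-! ### Null level sets of distance functions -/

/-- A zero set of a Lipschitz function is null if near each of its points the function grows
linearly along some direction: it has no density point. -/
theorem measure_zeroSet_of_linear_growth {E : Type*} [NormedAddCommGroup E] [NormedSpace ℝ E]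
    [FiniteDimensional ℝ E] [MeasurableSpace E] [BorelSpace E] (μ : Measure E)
    [μ.IsAddHaarMeasure] {Z : Set E} {g : E → ℝ} {K : NNReal} (hg : LipschitzWith K g)
    (hZm : MeasurableSet Z) (hZ : ∀ p ∈ Z, g p = 0)
    (h : ∀ p ∈ Z, ∃ v : E, ∃ c > 0, ∀ᶠ s in 𝓝[>] (0 : ℝ), c * s ≤ |g (p + s • v)|) :
    μ Z = 0 := by
  have hd := Besicovitch.ae_tendsto_measure_inter_div μ Z
  rw [ae_restrict_iff' hZm] at hd
  refine measure_mono_null (t := {p | ¬ (p ∈ Z → Tendsto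
    (fun r => μ (Z ∩ Metric.closedBall p r) / μ (Metric.closedBall p r)) (𝓝[>] 0) (𝓝 1))}) ?_ hd
  intro p hp hdp
  obtain ⟨v, c, hc, hv⟩ := h p hp
  -- The radius makes `K * radius < c`. At a density point, `Z` meets `p + s • ball v radius` for
  -- small `s`; the Lipschitz bound then gives `|g (p + s • v)| < c * s`, against the growth.
  have hr : 0 < c / (K + 1) := by positivity
  have hev := Measure.eventually_nonempty_inter_smul_of_density_one μ Z p (hdp hp)
    (Metric.ball v (c / (K + 1))) measurableSet_ball (Metric.measure_ball_pos μ v hr).ne'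
  obtain ⟨s, ⟨⟨y, hyZ, hy⟩, hs⟩, hs0⟩ := ((hev.and hv).and self_mem_nhdsWithin).exists
  have hs0 : 0 < s := hs0
  obtain ⟨a, ha, _, ⟨w, hw, rfl⟩, rfl⟩ := Set.mem_add.1 hy
  rw [mem_singleton_iff.1 ha] at hyZ
  have h1 := hg.dist_le_mul (p + s • v) (p + s • w)
  rw [hZ _ hyZ, Real.dist_eq, sub_zero, dist_add_left, dist_smul₀, Real.norm_eq_abs,
    abs_of_pos hs0] at h1
  have h2 : dist v w < c / (K + 1) := by rw [dist_comm]; exact hw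
  rw [lt_div_iff₀ (by positivity)] at h2
  have h3 : 0 ≤ dist v w := dist_nonneg
  nlinarith

/-- Moving from `p` towards a point `l` by the fraction `s` shrinks the distance to `l`. -/
theorem infDist_lineMap_le {E : Type*} [NormedAddCommGroup E] [NormedSpace ℝ E] {L : Set E}
    {p l : E} (hl : l ∈ L) (h : Metric.infDist p L = dist p l) {s : ℝ} (hs : s ≤ 1) :
    Metric.infDist (p + s • (l - p)) L ≤ (1 - s) * Metric.infDist p L := by
  refine (Metric.infDist_le_dist_of_mem hl).trans (le_of_eq ?_)
  rw [h, dist_eq_norm, dist_eq_norm,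
    show p + s • (l - p) - l = (1 - s) • (p - l) by module, norm_smul, Real.norm_eq_abs,
    abs_of_nonneg (by linarith)]

theorem eventually_pos_lt_one : ∀ᶠ s in 𝓝[>] (0 : ℝ), 0 < s ∧ s < 1 :=
  Ioo_mem_nhdsGT one_pos

section
variable {E : Type*} [NormedAddCommGroup E] [NormedSpace ℝ E] [FiniteDimensional ℝ E]
  [MeasurableSpace E] [BorelSpace E] (μ : Measure E) [μ.IsAddHaarMeasure]

/-- Moving towards a nearest point of `B` decreases the distance at rate `r`, which is the linear
growth required. -/
theorem measure_setOf_infDist_eq {B : Set E} (hB : IsClosed B) {r : ℝ} (hr : 0 < r) :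
    μ {p | Metric.infDist p B = r} = 0 := by
  have := FiniteDimensional.proper_real E
  rcases B.eq_empty_or_nonempty with rfl | hne
  · simp [Metric.infDist_empty, hr.ne]
  refine measure_zeroSet_of_linear_growth μ (g := fun p => Metric.infDist p B - r)
    (K := 1 + 0) ((Metric.lipschitz_infDist_pt B).sub (LipschitzWith.const r))
    (measurableSet_eq_fun (Metric.continuous_infDist_pt B).measurable measurable_const)
    (fun p hp => sub_eq_zero.2 hp) fun p hp => ?_
  obtain ⟨l, hl, hpl⟩ := hB.exists_infDist_eq_dist hne p
  refine ⟨l - p, r, hr, ?_⟩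
  filter_upwards [eventually_pos_lt_one] with s hs
  have h1 := infDist_lineMap_le hl hpl hs.2.le
  rw [mem_ofPred_eq] at hp
  rw [hp] at h1
  rw [abs_of_nonpos (by nlinarith)]
  nlinarith

/-- Move towards a nearest point of `L`: the `L` term drops at rate `β * d` with `d` the distance to
`L`, the `K` term by at most `α * d`. The growth degenerates on `L` itself, which is removed as a
null set. -/
theorem measure_setOf_mul_infDist_eq_of_lt {K L : Set E} (hL : IsClosed L) (hne : L.Nonempty)
    (hL0 : μ L = 0) {α β : ℝ} (hα : 0 < α) (hαβ : α < β) :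
    μ {p | α * Metric.infDist p K = β * Metric.infDist p L} = 0 := by
  have := FiniteDimensional.proper_real E
  have hsub : {p | α * Metric.infDist p K = β * Metric.infDist p L} ⊆
      ({p | α * Metric.infDist p K = β * Metric.infDist p L} \ L) ∪ L := by
    rw [sdiff_union_self]; exact subset_union_left
  refine measure_mono_null hsub (measure_union_null ?_ hL0)
  have hlip : LipschitzWith (‖α‖₊ * 1 + ‖β‖₊ * 1)
      (fun p => α * Metric.infDist p K - β * Metric.infDist p L) :=
    ((lipschitzWith_smul α).comp (Metric.lipschitz_infDist_pt K)).sub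
      ((lipschitzWith_smul β).comp (Metric.lipschitz_infDist_pt L))
  refine measure_zeroSet_of_linear_growth μ hlip
    ((measurableSet_eq_fun ((Metric.continuous_infDist_pt K).measurable.const_mul α)
      ((Metric.continuous_infDist_pt L).measurable.const_mul β)).diff hL.measurableSet)
    (fun p hp => sub_eq_zero.2 hp.1) fun p hp => ?_
  obtain ⟨l, hl, hpl⟩ := hL.exists_infDist_eq_dist hne p
  have hpos : 0 < Metric.infDist p L := (hL.notMem_iff_infDist_pos hne).1 hp.2
  refine ⟨l - p, (β - α) * Metric.infDist p L, by nlinarith, ?_⟩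
  filter_upwards [eventually_pos_lt_one] with s hs
  have h1 := infDist_lineMap_le hl hpl hs.2.le
  have h2 : Metric.infDist p K ≤ Metric.infDist (p + s • (l - p)) K + s * Metric.infDist p L := by
    refine Metric.infDist_le_infDist_add_dist.trans (add_le_add_right (le_of_eq ?_) _)
    rw [hpl, dist_eq_norm, dist_eq_norm,
      show p - (p + s • (l - p)) = s • (p - l) by module, norm_smul, Real.norm_eq_abs,
      abs_of_pos hs.1]
  have h3 : α * Metric.infDist p K = β * Metric.infDist p L := hp.1
  refine le_trans ?_ (le_abs_self _)
  nlinarith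

theorem measure_setOf_mul_infDist_eq {K L : Set E} (hK : IsClosed K) (hKne : K.Nonempty)
    (hK0 : μ K = 0) (hL : IsClosed L) (hLne : L.Nonempty) (hL0 : μ L = 0) {α β : ℝ}
    (hα : 0 < α) (hβ : 0 < β) (hne : α ≠ β) :
    μ {p | α * Metric.infDist p K = β * Metric.infDist p L} = 0 := by
  rcases hne.lt_or_gt with h | h
  · exact measure_setOf_mul_infDist_eq_of_lt μ hL hLne hL0 hα h
  · simpa only [eq_comm] using measure_setOf_mul_infDist_eq_of_lt μ (K := L) hK hKne hK0 hβ h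
end

/-- The points equidistant to a point and a closed set not containing it form a null set. -/
theorem measure_setOf_infDist_eq_dist {E : Type*} [NormedAddCommGroup E] [InnerProductSpace ℝ E]
    [FiniteDimensional ℝ E] [MeasurableSpace E] [BorelSpace E] (μ : Measure E)
    [μ.IsAddHaarMeasure] {K : Set E} (hK : IsClosed K) (hKne : K.Nonempty) {q : E} (hq : q ∉ K) :
    μ {p | Metric.infDist p K = dist p q} = 0 := by
  have := FiniteDimensional.proper_real E
  have hlip : LipschitzWith (1 + 1) (fun p => Metric.infDist p K - dist p q) :=
    (Metric.lipschitz_infDist_pt K).sub (LipschitzWith.dist_left q)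
  refine measure_zeroSet_of_linear_growth μ hlip
    (measurableSet_eq_fun (Metric.continuous_infDist_pt K).measurable
      (measurable_id.dist measurable_const)) (fun p hp => sub_eq_zero.2 hp) fun p hp => ?_
  have hR : 0 < Metric.infDist q K := (hK.notMem_iff_infDist_pos hKne).1 hq
  rw [mem_ofPred_eq] at hp
  have hρ : 0 < dist p q := by
    rcases eq_or_ne p q with rfl | hne
    · rw [dist_self] at hp; linarith
    · exact dist_pos.2 hne
  set R := Metric.infDist q K
  -- Write `ρ = dist p q` and `D` for the distance to `K` after moving by the fraction `s` towards
  -- `q`. Stewart's identity gives `D² - ((1 - s)ρ)² ≥ s R²`. The sum `D + (1 - s)ρ` is at most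
  -- `3ρ`, so dividing by it yields the rate `R² / (3ρ)`.
  refine ⟨q - p, R ^ 2 / (3 * dist p q), by positivity, ?_⟩
  filter_upwards [eventually_pos_lt_one] with s hs
  obtain ⟨k, hk, hpk⟩ := hK.exists_infDist_eq_dist hKne (p + s • (q - p))
  have h1 : dist (p + s • (q - p)) q = (1 - s) * dist p q := by
    rw [dist_eq_norm, dist_eq_norm, show p + s • (q - p) - q = (1 - s) • (p - q) by module,
      norm_smul, Real.norm_eq_abs, abs_of_nonneg (by linarith)]
  have h2 : Metric.infDist (p + s • (q - p)) K ≤ 2 * dist p q := by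
    refine Metric.infDist_le_infDist_add_dist (y := p).trans ?_
    have : dist (p + s • (q - p)) p = s * dist p q := by
      rw [dist_eq_norm, show p + s • (q - p) - p = s • (q - p) by module, norm_smul,
        Real.norm_eq_abs, abs_of_pos hs.1, ← dist_eq_norm, dist_comm q p]
    rw [hp, this]
    nlinarith
  have hpk' : dist p q ≤ dist p k := hp ▸ Metric.infDist_le_dist_of_mem hk
  have hqk : R ≤ dist q k := Metric.infDist_le_dist_of_mem hk
  have h3 : dist (p + s • (q - p)) k ^ 2 =
      (1 - s) * dist p k ^ 2 + s * dist q k ^ 2 - s * (1 - s) * dist p q ^ 2 := by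
    have e1 : p + s • (q - p) - k = (1 - s) • (p - k) + s • (q - k) := by module
    have e2 : p - q = (p - k) - (q - k) := by abel
    rw [dist_eq_norm, dist_eq_norm, dist_eq_norm, dist_eq_norm, e1, e2]
    generalize p - k = u
    generalize q - k = w
    rw [norm_add_sq_real, norm_sub_sq_real, inner_smul_left, inner_smul_right, norm_smul, norm_smul, mul_pow, mul_pow,
      Real.norm_eq_abs, Real.norm_eq_abs, sq_abs, sq_abs]
    simp only [conj_trivial]
    ring
  rw [hpk, h1] at *
  set D := dist (p + s • (q - p)) k
  have h4 : dist p q ^ 2 ≤ dist p k ^ 2 := by gcongr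
  have h5 : R ^ 2 ≤ dist q k ^ 2 := by gcongr
  have h6 : s * R ^ 2 ≤ (D - (1 - s) * dist p q) * (D + (1 - s) * dist p q) := by
    nlinarith
  have h7 : 0 ≤ D := dist_nonneg
  have h8 : 0 ≤ (1 - s) * dist p q := mul_nonneg (by linarith) hρ.le
  have h9 : 0 ≤ D - (1 - s) * dist p q := by
    by_contra hcon
    nlinarith [mul_pos hs.1 (pow_pos hR 2)]
  refine le_trans ?_ (le_abs_self _)
  rw [div_mul_eq_mul_div, div_le_iff₀ (by positivity)]
  nlinarith [mul_nonneg h9 (show 0 ≤ 3 * dist p q - (D + (1 - s) * dist p q) by nlinarith)]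

/-! ### The signed distance -/

theorem frontier_nonempty_of_isBounded {n : ℕ} (hn : 1 ≤ n) {A : Set (EuclideanSpace ℝ (Fin n))}
    (hA : A.Nonempty) (hb : Bornology.IsBounded A) : (frontier A).Nonempty ∧ A ≠ univ := by
  have : Nonempty (Fin n) := ⟨⟨0, hn⟩⟩
  have hu : A ≠ univ := by
    rintro rfl
    exact NormedSpace.unbounded_univ ℝ (EuclideanSpace ℝ (Fin n)) hb
  exact ⟨nonempty_frontier_iff.2 ⟨hA, hu⟩, hu⟩

theorem infDist_frontier_of_mem {E : Type*} [NormedAddCommGroup E] [NormedSpace ℝ E]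
    [FiniteDimensional ℝ E] {A : Set E} (hu : A ≠ univ) {p : E} (hp : p ∈ A) :
    Metric.infDist p (frontier A) = Metric.infDist p Aᶜ := by
  apply le_antisymm
  · obtain ⟨y, hy, h⟩ := exists_mem_frontier_infDist_compl_eq_dist hp hu
    exact h ▸ Metric.infDist_le_dist_of_mem hy
  · rw [← Metric.infDist_closure (s := Aᶜ)]
    refine Metric.infDist_le_infDist_of_subset ?_ (nonempty_frontier_iff.2 ⟨⟨p, hp⟩, hu⟩)
    rw [frontier_eq_closure_inter_closure]
    exact inter_subset_right

section
variable {n : ℕ} {A B : Set (EuclideanSpace ℝ (Fin n))} {p : EuclideanSpace ℝ (Fin n)}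

/-- This form without case distinction makes continuity and monotonicity in the set immediate. -/
theorem sgnDist_eq_infDist_sub (hA : A.Nonempty) (hu : A ≠ univ) :
    sgnDist p A = Metric.infDist p Aᶜ - Metric.infDist p A := by
  by_cases hp : p ∈ A
  · rw [sgnDist, if_pos hp, infDist_frontier_of_mem hu hp, Metric.infDist_zero_of_mem hp, sub_zero]
  · have hc : Aᶜ ≠ univ := fun h => hA.ne_empty (compl_univ_iff.1 h)
    have := infDist_frontier_of_mem hc (p := p) hp
    rw [frontier_compl, compl_compl] at this
    rw [sgnDist, if_neg hp, this, Metric.infDist_zero_of_mem (s := Aᶜ) hp, zero_sub]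

theorem abs_sgnDist : |sgnDist p A| = Metric.infDist p (frontier A) := by
  unfold sgnDist
  split_ifs
  · exact abs_of_nonneg Metric.infDist_nonneg
  · rw [abs_neg, abs_of_nonneg Metric.infDist_nonneg]

theorem continuous_sgnDist (hA : A.Nonempty) (hu : A ≠ univ) :
    Continuous fun p => sgnDist p A := by
  simp only [sgnDist_eq_infDist_sub hA hu]
  exact (Metric.continuous_infDist_pt _).sub (Metric.continuous_infDist_pt _)

theorem sgnDist_mono (hB : B.Nonempty) (hu : A ≠ univ) (h : B ⊆ A) : sgnDist p B ≤ sgnDist p A := by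
  have hBu : B ≠ univ := fun hh => hu (univ_subset_iff.1 (hh ▸ h))
  rw [sgnDist_eq_infDist_sub hB hBu, sgnDist_eq_infDist_sub (hB.mono h) hu]
  exact sub_le_sub (Metric.infDist_le_infDist_of_subset (compl_subset_compl.2 h)
    (nonempty_compl.2 hu)) (Metric.infDist_le_infDist_of_subset h hB)

theorem neg_dist_le_sgnDist {q : EuclideanSpace ℝ (Fin n)} (hq : q ∈ A) (hu : A ≠ univ) :
    -dist p q ≤ sgnDist p A := by
  rw [sgnDist_eq_infDist_sub ⟨q, hq⟩ hu]
  have h1 : Metric.infDist p A ≤ dist p q := Metric.infDist_le_dist_of_mem hq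
  have h2 : 0 ≤ Metric.infDist p Aᶜ := Metric.infDist_nonneg
  linarith

theorem sgnDist_eq_zero_iff (hA : A.Nonempty) (hu : A ≠ univ) :
    sgnDist p A = 0 ↔ p ∈ frontier A := by
  rw [← abs_eq_zero, abs_sgnDist, isClosed_frontier.mem_iff_infDist_zero
    (nonempty_frontier_iff.2 ⟨hA, hu⟩)]

theorem sgnDist_nonneg_of_mem (hp : p ∈ A) : 0 ≤ sgnDist p A := by
  rw [sgnDist, if_pos hp]; exact Metric.infDist_nonneg

theorem sgnDist_nonpos_of_notMem (hp : p ∉ A) : sgnDist p A ≤ 0 := by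
  rw [sgnDist, if_neg hp]; exact neg_nonpos.2 Metric.infDist_nonneg

theorem sgnDist_nonneg_iff (hA : A.Nonempty) (hu : A ≠ univ) :
    0 ≤ sgnDist p A ↔ p ∈ closure A := by
  rw [closure_eq_self_union_frontier]
  constructor
  · intro h
    by_cases hp : p ∈ A
    · exact Or.inl hp
    · exact Or.inr ((sgnDist_eq_zero_iff hA hu).1 (le_antisymm (sgnDist_nonpos_of_notMem hp) h))
  · rintro (h | h)
    · exact sgnDist_nonneg_of_mem h
    · exact ((sgnDist_eq_zero_iff hA hu).2 h).ge

/-- Every nonempty bounded set has a center. -/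
theorem exists_isCenter (hA : A.Nonempty) (hu : A ≠ univ) (hb : Bornology.IsBounded A) :
    ∃ p, IsCenter A p := by
  obtain ⟨p, hp, hmax⟩ := hb.isCompact_closure.exists_isMaxOn hA.closure
    (continuous_sgnDist hA hu).continuousOn
  -- `A` need not be closed. If the maximum over the closure is attained off `A`, it is at most `0`,
  -- while `d_S ≥ 0` on `A`; then every point of `A` is a center.
  by_cases hpA : p ∈ A
  · exact ⟨p, hpA, fun a ha => hmax (subset_closure ha)⟩
  · obtain ⟨a, ha⟩ := hA
    refine ⟨a, ha, fun b hb => ?_⟩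
    exact (hmax (subset_closure hb)).trans
      ((sgnDist_nonpos_of_notMem hpA).trans (sgnDist_nonneg_of_mem ha))

end

/-! ### Regular closed Jordan sets -/

section
variable {n : ℕ} {A B E S : Set (EuclideanSpace ℝ (Fin n))}

theorem closInt_mono (h : A ⊆ B) : closInt A ⊆ closInt B :=
  closure_mono (interior_mono h)

theorem interior_subset_closInt : interior A ⊆ closInt A := subset_closure

theorem closInt_subset_closure : closInt A ⊆ closure A := closure_mono interior_subset

theorem closInt_idem : closInt (closInt A) = closInt A := closure_interior_idem

theorem closInt_union (hA : closInt A = A) (hB : closInt B = B) : closInt (A ∪ B) = A ∪ B := by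
  apply Subset.antisymm
  · have hAc : IsClosed A := hA ▸ isClosed_closure
    have hBc : IsClosed B := hB ▸ isClosed_closure
    exact closInt_subset_closure.trans (hAc.union hBc).closure_eq.subset
  · exact union_subset (hA.symm.subset.trans (closInt_mono subset_union_left))
      (hB.symm.subset.trans (closInt_mono subset_union_right))

theorem frontier_subset_of_between (h1 : interior E ⊆ S) (h2 : S ⊆ closure E) :
    frontier S ⊆ frontier E :=
  sdiff_subset_sdiff (closure_minimal h2 isClosed_closure) (interior_maximal h1 isOpen_interior)

theorem ae_eq_of_between (h1 : interior E ⊆ S) (h2 : S ⊆ closure E)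
    (h0 : volume (frontier E) = 0) : S =ᵐ[volume] E := by
  filter_upwards [compl_mem_ae_iff.2 h0] with p hp
  have hp' : p ∈ closure E → p ∈ interior E := fun h => by_contra fun h' => hp ⟨h, h'⟩
  exact propext ⟨fun h => interior_subset (hp' (h2 h)), fun h => h1 (hp' (subset_closure h))⟩

namespace IsRegularJordan

protected theorem isClosed (hA : IsRegularJordan A) : IsClosed A := hA.2.1 ▸ isClosed_closure

theorem volume_ne_top (hA : IsRegularJordan A) : volume A ≠ ⊤ := hA.1.measure_lt_top.ne

theorem union (hA : IsRegularJordan A) (hB : IsRegularJordan B) : IsRegularJordan (A ∪ B) := by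
  refine ⟨hA.1.union hB.1, closInt_union hA.2.1 hB.2.1, ?_⟩
  exact measure_mono_null ((frontier_union_subset A B).trans
    (union_subset_union inter_subset_left inter_subset_right))
    (measure_union_null hA.2.2 hB.2.2)

theorem closInt_of_between (hb : Bornology.IsBounded E) (h0 : volume (frontier E) = 0)
    (h1 : interior E ⊆ closInt S) (h2 : closInt S ⊆ closure E) : IsRegularJordan (closInt S) :=
  ⟨hb.closure.subset h2, closInt_idem,
    measure_mono_null (frontier_subset_of_between h1 h2) h0⟩

end IsRegularJordan

/-! ### Admissible averages of nested sets -/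

/-- `S` is an admissible average of `B` and `A ⊇ B`, of measure `τ` together with `B`. -/
structure IsPartAverage (τ : ℝ) (A B S : Set (EuclideanSpace ℝ (Fin n))) : Prop where
  subset_closure : S ⊆ closure A
  isRegularJordan : IsRegularJordan (B ∪ S)
  volume_eq : volume.real (B ∪ S) = τ

/-- Since `B = ci(B) ⊆ ci(E)`, the union with `B` changes nothing, and `ci` alters `E` only within
its null frontier. -/
theorem isPartAverage_closInt (hB : IsRegularJordan B) (hBE : B ⊆ E) (hE : Bornology.IsBounded E)
    (hE0 : volume (frontier E) = 0) (hEA : E ⊆ closure A) :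
    IsPartAverage (volume.real E) A B (closInt E) := by
  have h1 : B ∪ closInt E = closInt E :=
    union_eq_right.2 (hB.2.1.symm.subset.trans (closInt_mono hBE))
  refine ⟨closInt_subset_closure.trans (closure_minimal hEA isClosed_closure), ?_, ?_⟩
  · rw [h1]
    exact IsRegularJordan.closInt_of_between hE hE0 interior_subset_closInt closInt_subset_closure
  · rw [h1]
    exact measureReal_congr
      (ae_eq_of_between interior_subset_closInt closInt_subset_closure hE0)

theorem targetMeasure_mem_Icc {t : ℝ} (ht : t ∈ Icc (0 : ℝ) 1)
    (h : volume.real B ≤ volume.real A) :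
    targetMeasure t A B ∈ Icc (volume.real B) (volume.real A) := by
  unfold targetMeasure
  constructor <;> nlinarith [ht.1, ht.2]

/-! ### Families of sets of continuously varying measure -/

theorem continuousOn_measureReal {α : Type*} [MeasurableSpace α] {μ : Measure α} {s : Set ℝ}
    {T : Set α} {E : ℝ → Set α} (hE : ∀ x, MeasurableSet (E x)) (hT : MeasurableSet T)
    (hTfin : μ T ≠ ⊤) (hsub : ∀ x ∈ s, E x ⊆ T)
    (hlim : ∀ x ∈ s, ∀ᵐ p ∂μ, ∀ᶠ y in 𝓝[s] x, (p ∈ E y ↔ p ∈ E x)) :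
    ContinuousOn (fun x => μ.real (E x)) s := by
  intro x hx
  refine (ENNReal.tendsto_toReal (measure_ne_top_of_subset (hsub x hx) hTfin)).comp ?_
  refine tendsto_measure_of_ae_tendsto_indicator _ (hE x) hE hT hTfin ?_ (hlim x hx)
  filter_upwards [self_mem_nhdsWithin] with y hy using hsub y hy

/-- Off the null level set at `x`, a point stays on the same side of the level for nearby
parameters. Dominated convergence makes the measure continuous on `[0, 1]`, and the intermediate
value theorem applies. -/
theorem exists_volume_superlevel_eq {a b : EuclideanSpace ℝ (Fin n) → ℝ} (ha : Continuous a)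
    (hb : Continuous b) (hle : ∀ p, b p ≤ a p) (hfin : volume {p | 0 ≤ a p} ≠ ⊤)
    (hnull : ∀ x ∈ Icc (0 : ℝ) 1, volume {p | x * a p + (1 - x) * b p = 0} = 0) {τ : ℝ}
    (hτ : τ ∈ Icc (volume.real {p | 0 ≤ b p}) (volume.real {p | 0 ≤ a p})) :
    ∃ x ∈ Icc (0 : ℝ) 1, volume.real {p | 0 ≤ x * a p + (1 - x) * b p} = τ := by
  have hc : ContinuousOn (fun x : ℝ => volume.real {p | 0 ≤ x * a p + (1 - x) * b p})
      (Icc 0 1) := by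
    refine continuousOn_measureReal (fun x => ?_) (T := {p | 0 ≤ a p}) ?_ hfin ?_ ?_
    · exact (isClosed_le continuous_const (by fun_prop)).measurableSet
    · exact (isClosed_le continuous_const ha).measurableSet
    · intro x hx p hp
      have h1 : 0 ≤ x * a p + (1 - x) * b p := hp
      show 0 ≤ a p
      nlinarith [hx.2, hle p]
    · intro x hx
      filter_upwards [compl_mem_ae_iff.2 (hnull x hx)] with p hp
      have hcont : ContinuousAt (fun y : ℝ => y * a p + (1 - y) * b p) x := by fun_prop
      have hp : x * a p + (1 - x) * b p ≠ 0 := hp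
      apply nhdsWithin_le_nhds
      rcases hp.lt_or_gt with h | h
      · filter_upwards [hcont.eventually (gt_mem_nhds h)] with y hy
        exact iff_of_false (not_le.2 hy) (not_le.2 h)
      · filter_upwards [hcont.eventually (lt_mem_nhds h)] with y hy
        exact iff_of_true hy.le h.le
  have := intermediate_value_Icc zero_le_one hc
  simp only [zero_mul, sub_zero, one_mul, zero_add, sub_self, add_zero] at this
  exact this hτ

/-! ### The reparametrized distance average -/

/-- The minimizer ranges over `[-N, N]` and may fall outside `[0, 1]`, where level sets are not
known to be null. For `x ≤ 0` the superlevel set lies in `B` up to a null set, which forces `τ =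
μ(B)`; for `x ≥ 1` it contains `closure A`, which forces `τ = μ(A)`. In both cases `ci` removes the
excess, because a null open set is empty. -/
theorem isPartAverage_superlevel (hB : IsRegularJordan B) (hBA : B ⊆ A)
    (hA : Bornology.IsBounded A) (hA0 : volume (frontier A) = 0)
    {a b : EuclideanSpace ℝ (Fin n) → ℝ} (ha : Continuous a) (hb : Continuous b)
    (hle : ∀ p, b p ≤ a p) (haA : {p | 0 ≤ a p} = closure A) (hBb : B ⊆ {p | 0 ≤ b p})
    (hbB : volume ({p | 0 ≤ b p} \ B) = 0)
    (hnull : ∀ x ∈ Ioo (0 : ℝ) 1, volume {p | x * a p + (1 - x) * b p = 0} = 0) {τ : ℝ}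
    (hτ : τ ∈ Icc (volume.real B) (volume.real A)) {x : ℝ}
    (hfin : Bornology.IsBounded {p | 0 ≤ x * a p + (1 - x) * b p})
    (hx : volume.real {p | 0 ≤ x * a p + (1 - x) * b p} = τ) :
    IsPartAverage τ A B (closInt {p | 0 ≤ x * a p + (1 - x) * b p}) := by
  have hcont : Continuous fun p => x * a p + (1 - x) * b p := by fun_prop
  have hclosed : IsClosed {p | 0 ≤ x * a p + (1 - x) * b p} := isClosed_le continuous_const hcont
  set E := {p | 0 ≤ x * a p + (1 - x) * b p} with hE
  have hAm : volume.real (closure A) = volume.real A :=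
    measureReal_congr (ae_eq_of_between (interior_subset.trans subset_closure) le_rfl hA0)
  rcases le_or_gt x 0 with hx0 | hx0
  · have hEb : E ⊆ {p | 0 ≤ b p} := fun p hp => by
      have h1 : 0 ≤ x * a p + (1 - x) * b p := hp
      show 0 ≤ b p
      nlinarith [hle p]
    have hint : interior E ⊆ B := by
      rw [← sdiff_eq_empty]
      refine (isOpen_interior.sdiff hB.isClosed).eq_empty_of_measure_zero
        (measure_mono_null (sdiff_subset_sdiff_left (interior_subset.trans hEb)) hbB)
    have hSB : closInt E ⊆ B := closure_minimal hint hB.isClosed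
    have hu : B ∪ closInt E = B := union_eq_left.2 hSB
    have hτB : τ = volume.real B := by
      refine le_antisymm ?_ hτ.1
      rw [← hx]
      refine ENNReal.toReal_mono hB.volume_ne_top ?_
      calc volume E ≤ volume (B ∪ ({p | 0 ≤ b p} \ B)) :=
            measure_mono (by rw [union_sdiff_self]; exact hEb.trans subset_union_right)
        _ ≤ volume B + volume ({p | 0 ≤ b p} \ B) := measure_union_le _ _
        _ = volume B := by rw [hbB, add_zero]
    exact ⟨(hSB.trans hBA).trans subset_closure, by rwa [hu], by rw [hu, hτB]⟩
  rcases lt_or_ge x 1 with hx1 | hx1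
  · rw [← hx]
    refine isPartAverage_closInt hB ?_ hfin ?_ ?_
    · intro p hp
      have h1 : 0 ≤ b p := hBb hp
      show 0 ≤ x * a p + (1 - x) * b p
      nlinarith [hle p]
    · refine measure_mono_null ?_ (hnull x ⟨hx0, hx1⟩)
      exact (frontier_le_subset_eq continuous_const hcont).trans fun p hp => Eq.symm hp
    · rw [← haA]
      intro p hp
      have h1 : 0 ≤ x * a p + (1 - x) * b p := hp
      show 0 ≤ a p
      nlinarith [hle p]
  · have hAE : closure A ⊆ E := by
      rw [← haA]
      intro p hp
      have h1 : 0 ≤ a p := hp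
      show 0 ≤ x * a p + (1 - x) * b p
      nlinarith [hle p]
    have hτA : τ = volume.real A := by
      refine le_antisymm hτ.2 ?_
      rw [← hx, ← hAm]
      exact measureReal_mono hAE hfin.measure_lt_top.ne
    have hnul : volume (E \ closure A) = 0 := by
      have h1 := measureReal_sdiff (μ := volume) hAE isClosed_closure.measurableSet
        hfin.measure_lt_top.ne
      rw [hx, hAm, hτA, sub_self] at h1
      exact (measureReal_eq_zero_iff
        (measure_ne_top_of_subset sdiff_subset hfin.measure_lt_top.ne)).1 h1
    have hint : interior E ⊆ closure A := by
      rw [← sdiff_eq_empty]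
      exact (isOpen_interior.sdiff isClosed_closure).eq_empty_of_measure_zero
        (measure_mono_null (sdiff_subset_sdiff_left interior_subset) hnul)
    have h1 : interior A ⊆ closInt E :=
      (interior_mono (subset_closure.trans hAE)).trans interior_subset_closInt
    have h2 : closInt E ⊆ closure A := closure_minimal hint isClosed_closure
    have hu : B ∪ closInt E = closInt E :=
      union_eq_right.2 (hB.2.1.symm.subset.trans
        (closInt_mono (hBA.trans (subset_closure.trans hAE))))
    refine ⟨h2, ?_, ?_⟩
    · rw [hu]; exact IsRegularJordan.closInt_of_between hA hA0 h1 h2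
    · rw [hu, hτA]; exact measureReal_congr (ae_eq_of_between h1 h2 hA0)
end

section
variable {n : ℕ} {A B : Set (EuclideanSpace ℝ (Fin n))}
  {q : Set (EuclideanSpace ℝ (Fin n)) → EuclideanSpace ℝ (Fin n)}

/-- Only `x > 1` is at issue: far out `d_S(p, A) ≤ R - ‖p‖` with weight `x`, while `b` falls at most
like `-‖p‖` with weight `1 - x`, so the combination is at most a constant minus `‖p‖`. Boundedness
gives finite measure, so `volume.real` is not the default value `0` of an infinite measure. -/
theorem isBounded_superlevel (hn : 1 ≤ n) (hA : Bornology.IsBounded A) (hAne : A.Nonempty)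
    {b : EuclideanSpace ℝ (Fin n) → ℝ} (hle : ∀ p, b p ≤ sgnDist p A) {C : ℝ}
    (hb : ∀ p, -(‖p‖ + C) ≤ b p) (x : ℝ) :
    Bornology.IsBounded {p | 0 ≤ x * sgnDist p A + (1 - x) * b p} := by
  obtain ⟨hfr, hu⟩ := frontier_nonempty_of_isBounded hn hAne hA
  obtain ⟨R, hR⟩ := (hA.closure).subset_closedBall 0
  have haR : ∀ p ∉ closure A, sgnDist p A ≤ R - ‖p‖ := by
    intro p hp
    have h1 : sgnDist p A = -Metric.infDist p (frontier A) := by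
      rw [sgnDist, if_neg fun h => hp (subset_closure h)]
    have h2 : ‖p‖ - R ≤ Metric.infDist p (frontier A) := by
      refine (Metric.le_infDist hfr).2 fun {y} hy => ?_
      have h3 := hR (frontier_subset_closure hy)
      rw [mem_closedBall_zero_iff] at h3
      have := norm_sub_norm_le p y
      rw [dist_eq_norm]
      linarith
    linarith
  rcases le_or_gt x 1 with hx | hx
  · refine hA.closure.subset fun p hp => ?_
    have h1 : 0 ≤ x * sgnDist p A + (1 - x) * b p := hp
    rw [← sgnDist_nonneg_iff hAne hu]
    nlinarith [hle p]
  · refine (hA.closure.union (Metric.isBounded_closedBall (x := 0)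
      (r := x * R + (x - 1) * C))).subset fun p hp => ?_
    by_cases hpA : p ∈ closure A
    · exact Or.inl hpA
    · right
      rw [mem_closedBall_zero_iff]
      have h1 : 0 ≤ x * sgnDist p A + (1 - x) * b p := hp
      nlinarith [haR p hpA, hb p]

/-- The absolute value of the relative signed distance is the distance to a closed null set. -/
theorem exists_abs_sgnDistRel (hn : 1 ≤ n) (hB : IsRegularJordan B) :
    ∃ L : Set (EuclideanSpace ℝ (Fin n)), IsClosed L ∧ L.Nonempty ∧ volume L = 0 ∧
      ∀ p, |sgnDistRel q A B p| = Metric.infDist p L := by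
  have : Nonempty (Fin n) := ⟨⟨0, hn⟩⟩
  rcases B.eq_empty_or_nonempty with rfl | hne
  · refine ⟨{q A}, isClosed_singleton, singleton_nonempty _, measure_singleton _, fun p => ?_⟩
    rw [sgnDistRel, if_pos rfl, abs_neg, abs_of_nonneg dist_nonneg, Metric.infDist_singleton]
  · refine ⟨frontier B, isClosed_frontier, (frontier_nonempty_of_isBounded hn hne hB.1).1,
      hB.2.2, fun p => ?_⟩
    rw [sgnDistRel, if_neg hne.ne_empty, abs_sgnDist]

theorem continuous_sgnDistRel (hn : 1 ≤ n) (hB : IsRegularJordan B) :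
    Continuous (sgnDistRel q A B) := by
  unfold sgnDistRel
  rcases B.eq_empty_or_nonempty with rfl | hne
  · simp only [if_true]
    fun_prop
  · simp only [if_neg hne.ne_empty]
    exact continuous_sgnDist hne (frontier_nonempty_of_isBounded hn hne hB.1).2

theorem isCenter_choice (hn : 1 ≤ n) (hq : IsCenterChoice q) (hAne : A.Nonempty)
    (hA : Bornology.IsBounded A) : IsCenter A (q A) :=
  hq A (exists_isCenter hAne (frontier_nonempty_of_isBounded hn hAne hA).2 hA)

theorem sgnDistRel_le (hn : 1 ≤ n) (hq : IsCenterChoice q) (hBA : B ⊆ A) (hAne : A.Nonempty)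
    (hA : Bornology.IsBounded A) (p : EuclideanSpace ℝ (Fin n)) :
    sgnDistRel q A B p ≤ sgnDist p A := by
  have hu := (frontier_nonempty_of_isBounded hn hAne hA).2
  rcases B.eq_empty_or_nonempty with rfl | hne
  · rw [sgnDistRel, if_pos rfl]
    exact neg_dist_le_sgnDist (isCenter_choice hn hq hAne hA).1 hu
  · rw [sgnDistRel, if_neg hne.ne_empty]
    exact sgnDist_mono hne hu hBA

theorem subset_sgnDistRel_nonneg : B ⊆ {p | 0 ≤ sgnDistRel q A B p} := fun p hp => by
  rw [mem_ofPred_eq, sgnDistRel, if_neg (nonempty_of_mem hp).ne_empty]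
  exact sgnDist_nonneg_of_mem hp

theorem volume_sgnDistRel_nonneg_diff (hn : 1 ≤ n) (hB : IsRegularJordan B) :
    volume ({p | 0 ≤ sgnDistRel q A B p} \ B) = 0 := by
  have : Nonempty (Fin n) := ⟨⟨0, hn⟩⟩
  rcases B.eq_empty_or_nonempty with rfl | hne
  · refine measure_mono_null (t := {q A}) ?_ (measure_singleton _)
    rintro p ⟨hp, -⟩
    rw [mem_ofPred_eq, sgnDistRel, if_pos rfl, neg_nonneg] at hp
    exact dist_le_zero.1 hp
  · refine measure_mono_null (t := ∅) ?_ measure_empty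
    rintro p ⟨hp, hpB⟩
    rw [mem_ofPred_eq, sgnDistRel, if_neg hne.ne_empty, sgnDist_nonneg_iff hne
      (frontier_nonempty_of_isBounded hn hne hB.1).2, hB.isClosed.closure_eq] at hp
    exact hpB hp

theorem avgFun_eq (hAne : A.Nonempty) (x : ℝ) (p : EuclideanSpace ℝ (Fin n)) :
    avgFun q A B x p = x * sgnDist p A + (1 - x) * sgnDistRel q A B p := by
  rw [avgFun, sgnDistRel.eq_def q B A, if_neg hAne.ne_empty]

/-- This keeps `B = ∅` out of the offset branch, where every thickening is empty. On the level set
`p` is equidistant from `q A` and the frontier; if the center lies on the frontier, `d_S ≤ 0`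
everywhere and only `p = q A` remains. -/
theorem zeroMeasureCondition_empty (hn : 1 ≤ n) (hq : IsCenterChoice q) (hAne : A.Nonempty)
    (hA : Bornology.IsBounded A) : ZeroMeasureCondition q A ∅ := by
  have : Nonempty (Fin n) := ⟨⟨0, hn⟩⟩
  obtain ⟨hfr, hu⟩ := frontier_nonempty_of_isBounded hn hAne hA
  have hc := isCenter_choice hn hq hAne hA
  unfold ZeroMeasureCondition
  simp only [avgFun_eq hAne, sgnDistRel, if_true]
  by_cases hqA : q A ∈ frontier A
  · refine measure_mono_null (t := {q A}) (fun p hp => ?_) (measure_singleton _)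
    have h0 := (sgnDist_eq_zero_iff hAne hu).2 hqA
    have h1 : sgnDist p A ≤ 0 := by
      by_cases hpA : p ∈ A
      · exact (hc.2 p hpA).trans h0.le
      · exact sgnDist_nonpos_of_notMem hpA
    rw [mem_ofPred_eq] at hp
    exact dist_le_zero.1 (by linarith)
  · refine measure_mono_null (fun p hp => ?_)
      (measure_setOf_infDist_eq_dist volume isClosed_frontier hfr hqA)
    rw [mem_ofPred_eq] at hp ⊢
    have h1 : sgnDist p A = dist p (q A) := by linarith
    rw [← abs_sgnDist, h1, abs_of_nonneg dist_nonneg]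

/-- A zero of the combination equates weighted distances to two closed null sets. Unequal positive
weights always give a null set, and at `x = 0` or `1` the level set lies in one of the two, so the
hypothesis is needed only at `1/2`. -/
theorem volume_levelSet (hn : 1 ≤ n) (hB : IsRegularJordan B) (hAne : A.Nonempty)
    (hA : Bornology.IsBounded A) (hA0 : volume (frontier A) = 0)
    (hz : ZeroMeasureCondition q A B) {x : ℝ} (hx : x ∈ Icc (0 : ℝ) 1) :
    volume {p | x * sgnDist p A + (1 - x) * sgnDistRel q A B p = 0} = 0 := by
  obtain ⟨L, hL, hLne, hL0, hLb⟩ := exists_abs_sgnDistRel (q := q) (A := A) hn hB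
  obtain ⟨hfr, hu⟩ := frontier_nonempty_of_isBounded hn hAne hA
  rcases hx.1.eq_or_lt with rfl | h0
  · refine measure_mono_null (fun p hp => ?_) hL0
    rw [hL.mem_iff_infDist_zero hLne, ← hLb, abs_eq_zero]
    simpa using hp
  rcases hx.2.eq_or_lt with rfl | h1
  · refine measure_mono_null (fun p hp => ?_) hA0
    rw [← sgnDist_eq_zero_iff hAne hu]
    simpa using hp
  rcases eq_or_ne x (1 / 2) with rfl | hne
  · unfold ZeroMeasureCondition at hz
    simpa only [avgFun_eq hAne] using hz
  · refine measure_mono_null (fun p hp => ?_) (measure_setOf_mul_infDist_eq volume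
      isClosed_frontier hfr hA0 hL hLne hL0 h0 (sub_pos.2 h1) fun h => hne (by linarith))
    rw [mem_ofPred_eq] at hp ⊢
    have h2 := congrArg abs (eq_neg_of_add_eq_zero_left hp)
    rwa [abs_neg, abs_mul, abs_mul, abs_of_pos h0, abs_of_pos (sub_pos.2 h1), abs_sgnDist,
      hLb] at h2

theorem distAverage_eq (hAne : A.Nonempty) (x : ℝ) :
    distAverage q x A B = {p | 0 ≤ x * sgnDist p A + (1 - x) * sgnDistRel q A B p} := by
  rw [distAverage, if_neg fun h => hAne.ne_empty h.1]
  simp only [avgFun_eq hAne]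

theorem isPartAverage_distAverage (hn : 1 ≤ n) {N : ℝ} (hN : 1 ≤ N) (hq : IsCenterChoice q)
    (hB : IsRegularJordan B) (hBA : B ⊆ A) (hAne : A.Nonempty) (hA : Bornology.IsBounded A)
    (hA0 : volume (frontier A) = 0) (hz : ZeroMeasureCondition q A B) {t : ℝ}
    (ht : t ∈ Icc (0 : ℝ) 1) :
    IsPartAverage (targetMeasure t A B) A B
      (closInt (distAverage q (Classical.epsilon (IsReparam N q t A B)) A B)) := by
  have hu := (frontier_nonempty_of_isBounded hn hAne hA).2
  have ha := continuous_sgnDist hAne hu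
  have hb := continuous_sgnDistRel (q := q) (A := A) hn hB
  have hle := sgnDistRel_le hn hq hBA hAne hA
  have hnull := fun x hx => volume_levelSet (x := x) hn hB hAne hA hA0 hz hx
  have haA : {p | 0 ≤ sgnDist p A} = closure A := by
    ext p; exact sgnDist_nonneg_iff hAne hu
  have hBb := subset_sgnDistRel_nonneg (q := q) (A := A) (B := B)
  have hbB := volume_sgnDistRel_nonneg_diff (q := q) (A := A) hn hB
  have hτ := targetMeasure_mem_Icc ht (measureReal_mono hBA hA.measure_lt_top.ne)
  have hAm : volume.real {p | 0 ≤ sgnDist p A} = volume.real A := by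
    rw [haA]
    exact measureReal_congr (ae_eq_of_between (interior_subset.trans subset_closure) le_rfl hA0)
  have hBm : volume.real {p | 0 ≤ sgnDistRel q A B p} = volume.real B := by
    refine measureReal_congr ?_
    filter_upwards [compl_mem_ae_iff.2 hbB] with p hp
    exact propext ⟨fun h => by_contra fun h' => hp ⟨h, h'⟩, fun h => hBb h⟩
  obtain ⟨x₀, hx₀, hx₀'⟩ := exists_volume_superlevel_eq ha hb hle
    (by rw [haA]; exact hA.closure.measure_lt_top.ne) hnull (by rwa [hAm, hBm])
  rw [← distAverage_eq hAne] at hx₀'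
  have hx₀N : x₀ ∈ Icc (-N) N := ⟨by linarith [hx₀.1], by linarith [hx₀.2]⟩
  -- As `N ≥ 1`, the exact solution `x₀ ∈ [0, 1]` competes in the minimization. So a minimizer
  -- exists, and every minimizer attains the target measure exactly.
  obtain ⟨hxN, hmin⟩ : IsReparam N q t A B (Classical.epsilon (IsReparam N q t A B)) := by
    refine Classical.epsilon_spec ⟨x₀, hx₀N, fun ξ _ => ?_⟩
    simp only [mem_ofPred_eq, hx₀', sub_self, abs_zero]
    exact abs_nonneg _
  generalize Classical.epsilon (IsReparam N q t A B) = x at *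
  have hx : volume.real (distAverage q x A B) = targetMeasure t A B := by
    have h := hmin hx₀N
    simp only [mem_ofPred_eq, hx₀', sub_self, abs_zero, abs_nonpos_iff, sub_eq_zero] at h
    exact h
  rw [distAverage_eq hAne] at hx ⊢
  obtain ⟨L, hL, ⟨l, hl⟩, hL0, hLb⟩ := exists_abs_sgnDistRel (q := q) (A := A) hn hB
  refine isPartAverage_superlevel hB hBA hA hA0 ha hb hle haA hBb hbB
    (fun x hx => hnull x (Ioo_subset_Icc_self hx)) hτ
    (isBounded_superlevel hn hA hAne hle (C := ‖l‖) (fun p => ?_) x) hx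
  have h1 : Metric.infDist p L ≤ ‖p‖ + ‖l‖ :=
    (Metric.infDist_le_dist_of_mem hl).trans (by rw [dist_eq_norm]; exact norm_sub_le p l)
  linarith [neg_abs_le (sgnDistRel q A B p), hLb p]

/-! ### The offset average -/

theorem mem_cthickening_iff_infDist_le (hB : B.Nonempty) {r : ℝ} (hr : 0 ≤ r)
    {p : EuclideanSpace ℝ (Fin n)} : p ∈ Metric.cthickening r B ↔ Metric.infDist p B ≤ r := by
  rw [Metric.mem_cthickening_iff, Metric.infDist, ENNReal.le_ofReal_iff_toReal_le
    (Metric.infEDist_ne_top hB) hr]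

theorem volume_frontier_cthickening (hB : IsRegularJordan B) {r : ℝ}
    (hr : 0 ≤ r) : volume (frontier (Metric.cthickening r B)) = 0 := by
  rcases hr.eq_or_lt with rfl | hr
  · rw [Metric.cthickening_zero, hB.isClosed.closure_eq]
    exact hB.2.2
  · refine measure_mono_null (fun p hp => ?_) (measure_setOf_infDist_eq volume hB.isClosed hr)
    have h1 : Metric.infEDist p B = ENNReal.ofReal r := Metric.frontier_cthickening_subset B hp
    rw [mem_ofPred_eq, Metric.infDist, h1, ENNReal.toReal_ofReal hr.le]

theorem volume_cthickening_inter_closure (hA0 : volume (frontier A) = 0) (r : ℝ) :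
    volume.real (Metric.cthickening r B ∩ closure A) =
      volume.real (Metric.cthickening r B ∩ A) :=
  measureReal_congr ((ae_eq_refl _).inter
    (ae_eq_of_between (interior_subset.trans subset_closure) le_rfl hA0))

theorem exists_isOffsetRadius (hB : IsRegularJordan B) (hBA : B ⊆ A) (hBne : B.Nonempty)
    (hA : Bornology.IsBounded A) (hA0 : volume (frontier A) = 0) {t : ℝ}
    (ht : t ∈ Icc (0 : ℝ) 1) : ∃ r, IsOffsetRadius t A B r := by
  -- `A` is not assumed measurable; `closure A` is, and differs from it by a null set.
  have hc : ContinuousOn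
      (fun r => volume.real (Metric.cthickening r B ∩ closure A)) (Ici 0) := by
    refine continuousOn_measureReal
      (fun r => (Metric.isClosed_cthickening.inter isClosed_closure).measurableSet)
      isClosed_closure.measurableSet hA.closure.measure_lt_top.ne
      (fun _ _ => inter_subset_right) ?_
    intro r hr
    -- The alternative `p ∈ B` is for `r = 0`, where the level set is `B` itself and not null; its
    -- points lie in every thickening anyway.
    have hlev : ∀ᵐ p, p ∈ B ∨ Metric.infDist p B ≠ r := by
      rcases (show 0 ≤ r from hr).eq_or_lt with rfl | hr
      · refine ae_of_all _ fun p => or_iff_not_imp_left.2 fun hp => ?_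
        exact ((hB.isClosed.notMem_iff_infDist_pos hBne).1 hp).ne'
      · filter_upwards [compl_mem_ae_iff.2
          (measure_setOf_infDist_eq volume hB.isClosed hr)] with p hp using Or.inr hp
    filter_upwards [hlev] with p hp
    rcases hp with hp | hp
    · refine Eventually.of_forall fun y => ?_
      simp only [mem_inter_iff, Metric.self_subset_cthickening B hp]
    · rcases hp.lt_or_gt with h | h
      · filter_upwards [self_mem_nhdsWithin, nhdsWithin_le_nhds (lt_mem_nhds h)] with y hy0 hy
        simp only [mem_inter_iff, mem_cthickening_iff_infDist_le hBne hy0,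
          mem_cthickening_iff_infDist_le hBne hr, hy.le, h.le]
      · filter_upwards [self_mem_nhdsWithin, nhdsWithin_le_nhds (gt_mem_nhds h)] with y hy0 hy
        simp only [mem_inter_iff, mem_cthickening_iff_infDist_le hBne hy0,
          mem_cthickening_iff_infDist_le hBne hr, not_le.2 hy, not_le.2 h]
  obtain ⟨b, hb⟩ := hBne
  obtain ⟨R, hR0, hR⟩ := hA.closure.subset_closedBall_lt 0 b
  have hivt := intermediate_value_Icc hR0.le (hc.mono Icc_subset_Ici_self)
  obtain ⟨r, hr, hr'⟩ := hivt (a := targetMeasure t A B) (by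
    have h0 : Metric.cthickening 0 B ∩ closure A = B := by
      rw [Metric.cthickening_zero, hB.isClosed.closure_eq]
      exact inter_eq_left.2 (hBA.trans subset_closure)
    have h1 : Metric.cthickening R B ∩ closure A = closure A := by
      refine inter_eq_right.2 fun p hp => ?_
      rw [mem_cthickening_iff_infDist_le ⟨b, hb⟩ hR0.le]
      exact (Metric.infDist_le_dist_of_mem hb).trans (hR hp)
    simp only [h0, h1]
    rw [measureReal_congr
      (ae_eq_of_between (S := closure A) (interior_subset.trans subset_closure) le_rfl hA0)]
    exact targetMeasure_mem_Icc ht (measureReal_mono hBA hA.measure_lt_top.ne))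
  refine ⟨r, hr.1, ?_⟩
  exact (volume_cthickening_inter_closure hA0 r).symm.trans hr'

theorem isPartAverage_offset (hB : IsRegularJordan B) (hBA : B ⊆ A) (hBne : B.Nonempty)
    (hA : Bornology.IsBounded A) (hA0 : volume (frontier A) = 0) {t : ℝ}
    (ht : t ∈ Icc (0 : ℝ) 1) :
    IsPartAverage (targetMeasure t A B) A B
      (closInt (Metric.cthickening (Classical.epsilon (IsOffsetRadius t A B)) B ∩ A)) := by
  obtain ⟨hr, hτ⟩ := Classical.epsilon_spec (exists_isOffsetRadius hB hBA hBne hA hA0 ht)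
  rw [← hτ]
  refine isPartAverage_closInt hB (subset_inter (Metric.self_subset_cthickening B) hBA)
    (hA.subset inter_subset_right) ?_ (inter_subset_right.trans subset_closure)
  exact measure_mono_null ((frontier_inter_subset _ _).trans
    (union_subset_union inter_subset_left inter_subset_right))
    (measure_union_null (volume_frontier_cthickening hB hr) hA0)

theorem isPartAverage_simpleAverage (hn : 1 ≤ n) {N : ℝ} (hN : 1 ≤ N) (hq : IsCenterChoice q)
    (hB : IsRegularJordan B) (hBA : B ⊆ A) (hAne : A.Nonempty) (hA : Bornology.IsBounded A)
    (hA0 : volume (frontier A) = 0) {t : ℝ} (ht : t ∈ Icc (0 : ℝ) 1) :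
    IsPartAverage (targetMeasure t A B) A B (simpleAverage N q t A B) := by
  unfold simpleAverage
  split_ifs with hz
  · exact isPartAverage_distAverage hn hN hq hB hBA hAne hA hA0 hz ht
  · refine isPartAverage_offset hB hBA (nonempty_iff_ne_empty.2 ?_) hA hA0 ht
    rintro rfl
    exact hz (zeroMeasureCondition_empty hn hq hAne hA)

end

section
variable {n : ℕ} {A B C D : Set (EuclideanSpace ℝ (Fin n))} {ε : ℝ}
  {q : Set (EuclideanSpace ℝ (Fin n)) → EuclideanSpace ℝ (Fin n)}

/-! ### Components and pieces -/

/-- `C` is a union of connected components of `D`. -/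
def IsComponentUnion (D C : Set (EuclideanSpace ℝ (Fin n))) : Prop :=
  C ⊆ D ∧ ∀ x ∈ C, connectedComponentIn D x ⊆ C

/-- Inside the open set `int A \ B` a small ball is connected, so once it meets `C` it lies in `C`.
Thus new frontier points cannot arise there. -/
theorem IsComponentUnion.frontier_subset (hA : IsClosed A) (hB : IsClosed B) (hBA : B ⊆ A)
    (hC : IsComponentUnion (A \ B) C) : frontier (B ∪ C) ⊆ frontier A ∪ frontier B := by
  rintro p ⟨hp, hp'⟩
  by_contra hcon
  rw [mem_union, not_or] at hcon
  have hpA : p ∈ A :=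
    closure_minimal (union_subset hBA (hC.1.trans sdiff_subset)) hA hp
  have hpAi : p ∈ interior A := by_contra fun h => hcon.1 ⟨subset_closure hpA, h⟩
  by_cases hpB : p ∈ B
  · exact hp' (interior_mono subset_union_left
      (by_contra fun h => hcon.2 ⟨subset_closure hpB, h⟩))
  · obtain ⟨r, hr, hball⟩ := Metric.isOpen_iff.1 (isOpen_interior.sdiff hB) p ⟨hpAi, hpB⟩
    obtain ⟨y, hyU, hy⟩ := mem_closure_iff_nhds.1 hp _ (Metric.ball_mem_nhds p hr)
    have hyC : y ∈ C := hy.resolve_left (hball hyU).2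
    have hsub : Metric.ball p r ⊆ C :=
      ((convex_ball p r).isPreconnected.subset_connectedComponentIn hyU
        (hball.trans (sdiff_subset_sdiff_left interior_subset))).trans (hC.2 y hyC)
    exact hp' (mem_interior_iff_mem_nhds.2 (mem_of_superset (Metric.ball_mem_nhds p hr)
      (hsub.trans subset_union_right)))

theorem IsComponentUnion.volume_frontier (hA : IsRegularJordan A) (hB : IsRegularJordan B)
    (hBA : B ⊆ A) (hC : IsComponentUnion (A \ B) C) : volume (frontier (B ∪ C)) = 0 :=
  measure_mono_null (hC.frontier_subset hA.isClosed hB.isClosed hBA)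
    (measure_union_null hA.2.2 hB.2.2)

theorem IsComponentUnion.nullMeasurableSet (hA : IsRegularJordan A) (hB : IsRegularJordan B)
    (hBA : B ⊆ A) (hC : IsComponentUnion (A \ B) C) : NullMeasurableSet C volume := by
  have h : C = (B ∪ C) \ B := by
    rw [union_sdiff_left]
    exact (sdiff_eq_left.2 (disjoint_left.2 fun x hx => (hC.1 hx).2)).symm
  rw [h]
  exact (nullMeasurableSet_of_null_frontier (hC.volume_frontier hA hB hBA)).diff
    hB.isClosed.measurableSet.nullMeasurableSet

theorem isComponentUnion_of_mem (hC : C ∈ componentsOf D) : IsComponentUnion D C := by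
  obtain ⟨x, hx, rfl⟩ := hC
  exact ⟨connectedComponentIn_subset D x, fun y hy => (connectedComponentIn_eq hy).symm.subset⟩

theorem IsComponentUnion.sUnion {P : Set (Set (EuclideanSpace ℝ (Fin n)))}
    (h : ∀ C ∈ P, IsComponentUnion D C) : IsComponentUnion D (⋃₀ P) := by
  refine ⟨sUnion_subset fun C hC => (h C hC).1, ?_⟩
  rintro x ⟨C, hC, hx⟩
  exact ((h C hC).2 x hx).trans (subset_sUnion_of_mem hC)

theorem nonempty_of_mem_componentsOf (hC : C ∈ componentsOf D) : C.Nonempty := by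
  obtain ⟨x, hx, rfl⟩ := hC
  exact ⟨x, mem_connectedComponentIn hx⟩

theorem pairwiseDisjoint_componentsOf : (componentsOf D).PairwiseDisjoint id := by
  rintro _ ⟨x, hx, rfl⟩ _ ⟨y, hy, rfl⟩ hne
  refine disjoint_left.2 fun z hzx hzy => hne ?_
  exact (connectedComponentIn_eq hzx).trans (connectedComponentIn_eq hzy).symm

theorem sUnion_componentsOf : ⋃₀ componentsOf D = D := by
  refine Subset.antisymm (sUnion_subset fun C hC => (isComponentUnion_of_mem hC).1) fun x hx => ?_
  exact ⟨_, ⟨x, hx, rfl⟩, mem_connectedComponentIn hx⟩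

theorem finite_large_components (hA : IsRegularJordan A) (hB : IsRegularJordan B) (hBA : B ⊆ A)
    (hε : 0 < ε) : {C ∈ componentsOf (A \ B) | ε ≤ volume.real C}.Finite := by
  have hfin : volume (A \ B) ≠ ⊤ := measure_ne_top_of_subset sdiff_subset hA.volume_ne_top
  have h := Measure.finite_const_le_meas_of_disjoint_iUnion₀ volume (ENNReal.ofReal_pos.2 hε)
    (As := fun C : componentsOf (A \ B) => (C : Set (EuclideanSpace ℝ (Fin n))))
    (fun C => (isComponentUnion_of_mem C.2).nullMeasurableSet hA hB hBA)
    (fun C C' hne => (pairwiseDisjoint_componentsOf C.2 C'.2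
      fun h => hne (Subtype.ext h)).aedisjoint)
    (by rwa [← sUnion_eq_iUnion, sUnion_componentsOf])
  refine (h.image Subtype.val).subset ?_
  rintro C ⟨hC, hCε⟩
  refine ⟨⟨C, hC⟩, ?_, rfl⟩
  exact ENNReal.ofReal_le_of_le_toReal hCε

/-- What the averages use about the decomposition of `A \ B` into pieces. -/
structure IsDecomposition (D : Set (EuclideanSpace ℝ (Fin n)))
    (P : Set (Set (EuclideanSpace ℝ (Fin n)))) : Prop where
  finite : P.Finite
  isComponentUnion : ∀ C ∈ P, IsComponentUnion D C
  nonempty : ∀ C ∈ P, C.Nonempty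
  pairwiseDisjoint : P.PairwiseDisjoint id
  sUnion_eq : ⋃₀ P = D

theorem isDecomposition_piecesOf (hA : IsRegularJordan A) (hB : IsRegularJordan B) (hBA : B ⊆ A)
    (hε : 0 < ε) : IsDecomposition (A \ B) (piecesOf ε (A \ B)) := by
  unfold piecesOf
  split_ifs with hf
  · exact ⟨hf, fun C hC => isComponentUnion_of_mem hC, fun C hC => nonempty_of_mem_componentsOf hC,
      pairwiseDisjoint_componentsOf, sUnion_componentsOf⟩
  have hlarge := finite_large_components hA hB hBA hε
  refine ⟨hlarge.insert _, ?_, ?_, ?_, ?_⟩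
  · rintro C (rfl | hC)
    · exact IsComponentUnion.sUnion fun C hC => isComponentUnion_of_mem hC.1
    · exact isComponentUnion_of_mem hC.1
  · rintro C (rfl | hC)
    -- There are infinitely many components but only finitely many large ones, so a small one
    -- exists.
    · obtain ⟨C, hC, hC'⟩ := Set.not_subset.1 fun h => hf (hlarge.subset h)
      obtain ⟨x, hx⟩ := nonempty_of_mem_componentsOf hC
      exact ⟨x, C, ⟨hC, not_le.1 fun h => hC' ⟨hC, h⟩⟩, hx⟩
    · exact nonempty_of_mem_componentsOf hC.1
  · refine (pairwiseDisjoint_insert).2 ⟨fun C hC C' hC' hne =>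
      pairwiseDisjoint_componentsOf hC.1 hC'.1 hne, fun C hC _ => ?_⟩
    refine disjoint_sUnion_left.2 fun C' hC' => pairwiseDisjoint_componentsOf hC'.1 hC.1 ?_
    rintro rfl
    exact not_le.2 hC'.2 hC.2
  · rw [sUnion_insert, ← sUnion_union]
    conv_rhs => rw [← sUnion_componentsOf (D := A \ B)]
    congr 1
    ext C
    constructor
    · rintro (h | h) <;> exact h.1
    · intro h
      exact (lt_or_ge (volume.real C) ε).imp (fun h' => ⟨h, h'⟩) fun h' => ⟨h, h'⟩

/-! ### The average of nested sets -/

theorem IsRegularJordan.union_biUnion {ι : Type*} {S : ι → Set (EuclideanSpace ℝ (Fin n))}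
    (hB : IsRegularJordan B) (F : Finset ι) (h : ∀ i ∈ F, IsRegularJordan (B ∪ S i)) :
    IsRegularJordan (B ∪ ⋃ i ∈ F, S i) := by
  classical
  induction F using Finset.induction_on with
  | empty => simpa using hB
  | insert i F _ ih =>
    rw [Finset.set_biUnion_insert, union_union_distrib_left]
    exact (h i (Finset.mem_insert_self i F)).union
      (ih fun j hj => h j (Finset.mem_insert_of_mem hj))

/-- Each `S C \ B` has measure `t μ(C)` and lies in `C` up to the null frontier of `B ∪ C`. Hence
these parts are almost disjoint, and summing over the finitely many pieces gives `t μ(A \ B)`. -/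
theorem isPartAverage_biUnion {P : Set (Set (EuclideanSpace ℝ (Fin n)))} {t : ℝ}
    (hA : IsRegularJordan A) (hB : IsRegularJordan B) (hBA : B ⊆ A)
    (hP : IsDecomposition (A \ B) P)
    {S : Set (EuclideanSpace ℝ (Fin n)) → Set (EuclideanSpace ℝ (Fin n))}
    (hS : ∀ C ∈ P, IsPartAverage (targetMeasure t (B ∪ C) B) (B ∪ C) B (S C)) :
    IsPartAverage (targetMeasure t A B) A B (⋃ C ∈ P, S C) := by
  obtain ⟨F, rfl⟩ := hP.finite.exists_finset_coe
  have hCA : ∀ C ∈ F, B ∪ C ⊆ A := fun C hC =>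
    union_subset hBA ((hP.isComponentUnion C hC).1.trans sdiff_subset)
  have hBm := hB.isClosed.measurableSet
  have hfin : ∀ {X : Set (EuclideanSpace ℝ (Fin n))}, X ⊆ A → volume X ≠ ⊤ := fun h =>
    measure_ne_top_of_subset h hA.volume_ne_top
  have hSA : ∀ C ∈ F, S C ⊆ A := fun C hC =>
    (hS C hC).subset_closure.trans (closure_minimal (hCA C hC) hA.isClosed)
  have hdiff : ∀ {X : Set (EuclideanSpace ℝ (Fin n))}, X ⊆ A →
      volume.real (X \ B) = volume.real (B ∪ X) - volume.real B := fun {X} hX => by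
    rw [← measureReal_sdiff subset_union_left hBm (hfin (union_subset hBA hX)),
      union_sdiff_left]
  have hdec : ∀ C ∈ F, C \ B = C := fun C hC =>
    sdiff_eq_left.2 (disjoint_left.2 fun x hx => ((hP.isComponentUnion C hC).1 hx).2)
  have hpart : ∀ C ∈ F, volume.real (S C \ B) = t * volume.real C := by
    intro C hC
    have h1 := hdiff (subset_union_right.trans (hCA C hC))
    rw [hdec C hC] at h1
    rw [hdiff (hSA C hC), (hS C hC).volume_eq, targetMeasure, h1]
    ring
  have hsub : ∀ C ∈ F, S C \ B ⊆ C ∪ frontier (B ∪ C) := by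
    rintro C hC x ⟨hx, hxB⟩
    have h1 := (hS C hC).subset_closure hx
    rw [closure_eq_self_union_frontier] at h1
    exact h1.imp_left fun h => h.resolve_left hxB
  have hfr : ∀ C ∈ F, volume (frontier (B ∪ C)) = 0 := fun C hC =>
    (hP.isComponentUnion C hC).volume_frontier hA hB hBA
  refine ⟨?_, ?_, ?_⟩
  · exact (iUnion₂_subset hSA).trans subset_closure
  · exact hB.union_biUnion F fun C hC => (hS C hC).isRegularJordan
  have hXA : (⋃ C ∈ (F : Set (Set (EuclideanSpace ℝ (Fin n)))), S C) ⊆ A := iUnion₂_subset hSA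
  have hX : volume.real ((⋃ C ∈ F, S C) \ B) = t * volume.real (A \ B) := by
    rw [← hP.sUnion_eq, sUnion_eq_biUnion]
    simp only [Finset.mem_coe, iUnion_sdiff]
    rw [measureReal_biUnion_finset₀ ?_ ?_ fun C hC => hfin (sdiff_subset.trans (hSA C hC)),
      measureReal_biUnion_finset₀ ?_ ?_ fun C hC =>
        hfin (subset_union_right.trans (hCA C hC)), Finset.mul_sum]
    · exact Finset.sum_congr rfl hpart
    · exact fun C hC C' hC' hne => (hP.pairwiseDisjoint hC hC' hne).aedisjoint
    · exact fun C hC => (hP.isComponentUnion C hC).nullMeasurableSet hA hB hBA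
    · intro C hC C' hC' hne
      refine measure_mono_null ?_ (measure_union_null (hfr C hC) (hfr C' hC'))
      rintro x ⟨hx, hx'⟩
      rcases hsub C hC hx with h | h
      · rcases hsub C' hC' hx' with h' | h'
        · exact (disjoint_left.1 (hP.pairwiseDisjoint hC hC' hne) h h').elim
        · exact Or.inr h'
      · exact Or.inl h
    · intro C hC
      rw [← union_sdiff_left]
      exact ((hS C hC).isRegularJordan.isClosed.measurableSet.diff hBm).nullMeasurableSet
  have h1 := hdiff hXA
  have h2 := measureReal_sdiff hBA hBm hA.volume_ne_top
  simp only [Finset.mem_coe] at h1 ⊢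
  rw [targetMeasure]
  linarith [h1.symm.trans hX, congrArg (t * ·) h2]

theorem nestedAverage_spec (hn : 1 ≤ n) {N : ℝ} (hN : 1 ≤ N) (hε : 0 < ε)
    (hq : IsCenterChoice q) (hA : IsRegularJordan A) (hB : IsRegularJordan B) (hBA : B ⊆ A)
    {t : ℝ} (ht : t ∈ Icc (0 : ℝ) 1) :
    IsPartAverage (targetMeasure t A B) A B (nestedAverage N ε q t A B) := by
  unfold nestedAverage
  split_ifs with h
  · subst h
    refine ⟨subset_closure, by rwa [union_self], ?_⟩
    rw [union_self, targetMeasure]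
    ring
  · have hP := isDecomposition_piecesOf hA hB hBA hε
    refine isPartAverage_biUnion hA hB hBA hP fun C hC => ?_
    have hCA : B ∪ C ⊆ A := union_subset hBA ((hP.isComponentUnion C hC).1.trans sdiff_subset)
    exact isPartAverage_simpleAverage hn hN hq hB subset_union_left
      ((hP.nonempty C hC).mono subset_union_right) (hA.1.subset hCA)
      ((hP.isComponentUnion C hC).volume_frontier hA hB hBA) ht

/-- Here `ci(A ∩ B) = B`, and the second half of the average is `B` averaged with itself; hence the
union with `B` throughout. -/
theorem measureAverage_of_superset {N t : ℝ} (hB : IsRegularJordan B) (hBA : B ⊆ A) :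
    measureAverage N ε q t A B = B ∪ nestedAverage N ε q t A B := by
  rw [measureAverage, inter_eq_right.2 hBA, hB.2.1, nestedAverage.eq_def N ε q (1 - t), if_pos rfl,
    union_comm]

theorem measureAverage_of_subset {N t : ℝ} (hA : IsRegularJordan A) (hAB : A ⊆ B) :
    measureAverage N ε q t A B = A ∪ nestedAverage N ε q (1 - t) B A := by
  rw [measureAverage, inter_eq_left.2 hAB, hA.2.1, nestedAverage.eq_def N ε q t, if_pos rfl]

/-- The measure average of nested sets is a regular Jordan set between them, and its measure is the
corresponding average of their measures. -/
theorem measureAverage_spec (hn : 1 ≤ n) {N : ℝ} (hN : 1 ≤ N) (hε : 0 < ε)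
    (hq : IsCenterChoice q) (hA : IsRegularJordan A) (hB : IsRegularJordan B)
    (h : A ⊆ B ∨ B ⊆ A) {t : ℝ} (ht : t ∈ Icc (0 : ℝ) 1) :
    IsRegularJordan (measureAverage N ε q t A B) ∧ A ∩ B ⊆ measureAverage N ε q t A B ∧
      measureAverage N ε q t A B ⊆ A ∪ B ∧
      volume.real (measureAverage N ε q t A B) = targetMeasure t A B := by
  rcases h with h | h
  · have hs := nestedAverage_spec hn hN hε hq hB hA h (t := 1 - t)
      ⟨by linarith [ht.2], by linarith [ht.1]⟩
    rw [measureAverage_of_subset hA h]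
    refine ⟨hs.isRegularJordan, inter_subset_left.trans subset_union_left,
      union_subset_union_right A (hs.subset_closure.trans hB.isClosed.closure_eq.subset), ?_⟩
    rw [hs.volume_eq, targetMeasure, targetMeasure]
    ring
  · have hs := nestedAverage_spec hn hN hε hq hA hB h ht
    rw [measureAverage_of_superset hB h]
    refine ⟨hs.isRegularJordan, inter_subset_right.trans subset_union_left, ?_, hs.volume_eq⟩
    exact union_subset subset_union_right
      ((hs.subset_closure.trans hA.isClosed.closure_eq.subset).trans subset_union_left)

end

/-! ### Lane-Riesenfeld refinement of chains -/

/-- The linear average of real numbers. -/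
abbrev linearAverage (t a b : ℝ) : ℝ := t * a + (1 - t) * b

/-- An average of comparable elements that stays between them, and on whose values `μ` is affine. -/
structure IsChainAverage {X : Type*} (avg : ℝ → X → X → X) (P : X → Prop) (r : X → X → Prop)
    (μ : X → ℝ) : Prop where
  refl : ∀ a, r a a
  trans : ∀ {a b c}, r a b → r b c → r a c
  mem : ∀ {t a b}, t ∈ Icc (0 : ℝ) 1 → P a → P b → r a b → P (avg t a b)
  left : ∀ {t a b}, t ∈ Icc (0 : ℝ) 1 → P a → P b → r a b → r a (avg t a b)
  right : ∀ {t a b}, t ∈ Icc (0 : ℝ) 1 → P a → P b → r a b → r (avg t a b) b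
  map : ∀ {t a b}, t ∈ Icc (0 : ℝ) 1 → P a → P b → r a b →
    μ (avg t a b) = linearAverage t (μ a) (μ b)

/-- A chain of elements satisfying `P`, indexed by the integers. -/
structure IsIntChain {X : Type*} (P : X → Prop) (r : X → X → Prop) (F : ℤ → X) : Prop where
  mem : ∀ i, P (F i)
  succ : ∀ i, r (F i) (F (i + 1))

theorem half_mem_Icc : (1 / 2 : ℝ) ∈ Icc (0 : ℝ) 1 := by norm_num

section
variable {X : Type*} {avg : ℝ → X → X → X} {P : X → Prop} {r : X → X → Prop} {μ : X → ℝ}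
  {F : ℤ → X} {m : ℕ}

theorem doublingStep_of_even {i : ℤ} (c : ℤ) (h : i = 2 * c) : doublingStep avg F i = F c := by
  rw [doublingStep, if_pos (by rw [h]; exact even_two_mul c)]
  congr 1
  omega

theorem doublingStep_of_odd {i : ℤ} (c : ℤ) (h : i = 2 * c + 1) :
    doublingStep avg F i = avg (1 / 2) (F c) (F (c + 1)) := by
  have h1 : ¬ Even i := by rw [Int.not_even_iff_odd]; exact ⟨c, h⟩
  have h2 : i / 2 = c := by omega
  rw [doublingStep, if_neg h1, h2]

namespace IsChainAverage

theorem rel_of_le (h : IsChainAverage avg P r μ) (hF : IsIntChain P r F) {i j : ℤ} (hij : i ≤ j) :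
    r (F i) (F j) := by
  induction j, hij using Int.leInduction with
  | base => exact h.refl _
  | succ j _ ih => exact h.trans ih (hF.succ j)

theorem isIntChain_doublingStep (h : IsChainAverage avg P r μ) (hF : IsIntChain P r F) :
    IsIntChain P r (doublingStep avg F) := by
  refine ⟨fun i => ?_, fun i => ?_⟩
  · obtain ⟨c, hc⟩ := Int.even_or_odd' i
    rcases hc with hc | hc
    · rw [doublingStep_of_even c hc]; exact hF.mem c
    · rw [doublingStep_of_odd c hc]
      exact h.mem half_mem_Icc (hF.mem _) (hF.mem _) (hF.succ c)
  · obtain ⟨c, hc⟩ := Int.even_or_odd' i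
    rcases hc with hc | hc
    · rw [doublingStep_of_even c hc, doublingStep_of_odd (i := i + 1) c (by omega)]
      exact h.left half_mem_Icc (hF.mem _) (hF.mem _) (hF.succ c)
    · rw [doublingStep_of_odd c hc, doublingStep_of_even (i := i + 1) (c + 1) (by omega)]
      exact h.right half_mem_Icc (hF.mem _) (hF.mem _) (hF.succ c)

theorem isIntChain_averagingStep (h : IsChainAverage avg P r μ) (hF : IsIntChain P r F) :
    IsIntChain P r (averagingStep avg F) :=
  ⟨fun i => h.mem half_mem_Icc (hF.mem _) (hF.mem _) (hF.succ i), fun i =>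
    h.trans (h.right half_mem_Icc (hF.mem _) (hF.mem _) (hF.succ i))
      (h.left half_mem_Icc (hF.mem _) (hF.mem _) (hF.succ _))⟩

theorem isIntChain_averagingStep_iterate (h : IsChainAverage avg P r μ) (hF : IsIntChain P r F) (k : ℕ) :
    IsIntChain P r ((averagingStep avg)^[k] F) := by
  induction k with
  | zero => exact hF
  | succ k ih => rw [Function.iterate_succ_apply']; exact h.isIntChain_averagingStep ih

theorem averagingStep_iterate_between (h : IsChainAverage avg P r μ) (hF : IsIntChain P r F)
    (k : ℕ) (i : ℤ) : r (F i) ((averagingStep avg)^[k] F i) ∧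
      r ((averagingStep avg)^[k] F i) (F (i + k)) := by
  induction k generalizing i with
  | zero => simpa using h.refl (F i)
  | succ k ih =>
    have hk := h.isIntChain_averagingStep_iterate hF k
    rw [Function.iterate_succ_apply']
    refine ⟨h.trans (ih i).1 (h.left half_mem_Icc (hk.mem _) (hk.mem _) (hk.succ i)),
      h.trans (h.right half_mem_Icc (hk.mem _) (hk.mem _) (hk.succ i)) ?_⟩
    have := (ih (i + 1)).2
    rwa [show i + 1 + (k : ℤ) = i + ((k + 1 : ℕ) : ℤ) by push_cast; ring] at this

theorem isIntChain_refineStep (h : IsChainAverage avg P r μ) (hF : IsIntChain P r F) :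
    IsIntChain P r (refineStep avg m F) := by
  have hk := h.isIntChain_averagingStep_iterate (h.isIntChain_doublingStep hF) (m - 1)
  refine ⟨fun i => hk.mem _, fun i => ?_⟩
  have := hk.succ (i - (((m - 1) / 2 : ℕ) : ℤ))
  rwa [sub_add_eq_add_sub] at this

theorem isIntChain_refineStep_iterate (h : IsChainAverage avg P r μ) (hF : IsIntChain P r F) (k : ℕ) :
    IsIntChain P r ((refineStep avg m)^[k] F) := by
  induction k with
  | zero => exact hF
  | succ k ih => rw [Function.iterate_succ_apply']; exact h.isIntChain_refineStep ih

theorem rel_doublingStep (h : IsChainAverage avg P r μ) (hF : IsIntChain P r F) {a i : ℤ}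
    (ha : 2 * a ≤ i) : r (F a) (doublingStep avg F i) := by
  rw [← doublingStep_of_even (avg := avg) (F := F) a rfl]
  exact h.rel_of_le (h.isIntChain_doublingStep hF) ha

theorem doublingStep_rel (h : IsChainAverage avg P r μ) (hF : IsIntChain P r F) {b i : ℤ}
    (hb : i ≤ 2 * b) : r (doublingStep avg F i) (F b) := by
  rw [← doublingStep_of_even (avg := avg) (F := F) b rfl]
  exact h.rel_of_le (h.isIntChain_doublingStep hF) hb

/-- A refined element lies between the first and last of the `m` doubled elements it averages. With
the shift, an index margin of `m` on either side is always enough. -/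
theorem rel_refineStep (h : IsChainAverage avg P r μ) (hF : IsIntChain P r F) {a i : ℤ}
    (ha : 2 * a + m ≤ i) : r (F a) (refineStep avg m F i) :=
  h.trans (h.rel_doublingStep hF (by omega))
    (h.averagingStep_iterate_between (h.isIntChain_doublingStep hF) (m - 1) _).1

theorem refineStep_rel (h : IsChainAverage avg P r μ) (hF : IsIntChain P r F) {b i : ℤ}
    (hb : i + m ≤ 2 * b) : r (refineStep avg m F i) (F b) :=
  h.trans (h.averagingStep_iterate_between (h.isIntChain_doublingStep hF) (m - 1) _).2
    (h.doublingStep_rel hF (by omega))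

theorem map_doublingStep (h : IsChainAverage avg P r μ) (hF : IsIntChain P r F) (i : ℤ) :
    μ (doublingStep avg F i) = doublingStep linearAverage (fun i => μ (F i)) i := by
  unfold doublingStep
  split_ifs
  · rfl
  · exact h.map half_mem_Icc (hF.mem _) (hF.mem _) (hF.succ _)

theorem map_averagingStep_iterate (h : IsChainAverage avg P r μ) (hF : IsIntChain P r F) (k : ℕ)
    (i : ℤ) : μ ((averagingStep avg)^[k] F i) =
      (averagingStep linearAverage)^[k] (fun i => μ (F i)) i := by
  induction k generalizing i with
  | zero => rfl
  | succ k ih =>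
    have hk := h.isIntChain_averagingStep_iterate hF k
    rw [Function.iterate_succ_apply', Function.iterate_succ_apply']
    refine (h.map half_mem_Icc (hk.mem _) (hk.mem _) (hk.succ _)).trans ?_
    rw [ih, ih]
    rfl

theorem map_refineStep (h : IsChainAverage avg P r μ) (hF : IsIntChain P r F) (i : ℤ) :
    μ (refineStep avg m F i) = refineStep linearAverage m (fun i => μ (F i)) i := by
  unfold refineStep
  rw [h.map_averagingStep_iterate (h.isIntChain_doublingStep hF)]
  rw [funext (h.map_doublingStep hF)]

theorem map_refineStep_iterate (h : IsChainAverage avg P r μ) (hF : IsIntChain P r F) (k : ℕ)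
    (i : ℤ) : μ ((refineStep avg m)^[k] F i) =
      (refineStep linearAverage m)^[k] (fun i => μ (F i)) i := by
  induction k generalizing i with
  | zero => rfl
  | succ k ih =>
    rw [Function.iterate_succ_apply', Function.iterate_succ_apply',
      h.map_refineStep (h.isIntChain_refineStep_iterate hF k)]
    congr 1
    exact funext ih

theorem interpolant_weight_mem_Icc (k : ℕ) (x : ℝ) :
    (⌊x * 2 ^ k⌋ : ℝ) + 1 - x * 2 ^ k ∈ Icc (0 : ℝ) 1 :=
  ⟨by linarith [Int.lt_floor_add_one (x * 2 ^ k)], by linarith [Int.floor_le (x * 2 ^ k)]⟩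

theorem interpolant_spec (h : IsChainAverage avg P r μ) (hF : IsIntChain P r F) (k : ℕ) (x : ℝ) :
    P (interpolant avg k F x) ∧ r (F ⌊x * 2 ^ k⌋) (interpolant avg k F x) ∧
      r (interpolant avg k F x) (F (⌊x * 2 ^ k⌋ + 1)) ∧
      μ (interpolant avg k F x) = interpolant linearAverage k (fun i => μ (F i)) x :=
  have hw := interpolant_weight_mem_Icc k x
  ⟨h.mem hw (hF.mem _) (hF.mem _) (hF.succ _), h.left hw (hF.mem _) (hF.mem _) (hF.succ _),
    h.right hw (hF.mem _) (hF.mem _) (hF.succ _), h.map hw (hF.mem _) (hF.mem _) (hF.succ _)⟩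

end IsChainAverage

end

/-! ### Contraction of differences -/

theorem doublingStep_linearAverage_succ_sub (f : ℤ → ℝ) (i : ℤ) :
    doublingStep linearAverage f (i + 1) - doublingStep linearAverage f i =
      (f (i / 2 + 1) - f (i / 2)) / 2 := by
  obtain ⟨c, hc⟩ := Int.even_or_odd' i
  have h2 : i / 2 = c := by omega
  rw [h2]
  rcases hc with hc | hc
  · rw [doublingStep_of_even c hc, doublingStep_of_odd (i := i + 1) c (by omega)]
    ring
  · rw [doublingStep_of_odd c hc, doublingStep_of_even (i := i + 1) (c + 1) (by omega)]
    ring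

theorem averagingStep_iterate_abs_sub_le {f : ℤ → ℝ} {M : ℝ} (k : ℕ) {i : ℤ}
    (h : ∀ l, i ≤ l → l ≤ i + k → |f (l + 1) - f l| ≤ M) :
    |(averagingStep linearAverage)^[k] f (i + 1) - (averagingStep linearAverage)^[k] f i| ≤ M := by
  induction k generalizing i with
  | zero => exact h i le_rfl (by simp)
  | succ k ih =>
    have h0 := ih (i := i) fun l hl hl' => h l hl (by push_cast; omega)
    have h1 := ih (i := i + 1) fun l hl hl' => h l (by omega) (by push_cast; omega)
    rw [Function.iterate_succ_apply', averagingStep, averagingStep, linearAverage, linearAverage]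
    rw [abs_le] at *
    constructor <;> linarith [h0.1, h0.2, h1.1, h1.2]

/-- Doubling halves differences and averaging does not increase them. The bound is restricted to a
window because differences over all of `ℤ` may be unbounded. -/
theorem refineStep_abs_sub_le {f : ℤ → ℝ} {M : ℝ} {m : ℕ} (hm : 1 ≤ m) {a b i : ℤ}
    (h : ∀ j, a ≤ j → j < b → |f (j + 1) - f j| ≤ M) (ha : 2 * a + m ≤ i) (hb : i + m < 2 * b) :
    |refineStep linearAverage m f (i + 1) - refineStep linearAverage m f i| ≤ M / 2 := by
  unfold refineStep
  rw [← sub_add_eq_add_sub]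
  refine averagingStep_iterate_abs_sub_le _ fun l hl hl' => ?_
  rw [doublingStep_linearAverage_succ_sub, abs_div, abs_two]
  gcongr
  exact h _ (by omega) (by omega)

theorem floor_mul_two_pow_succ (x : ℝ) (k : ℕ) :
    2 * ⌊x * 2 ^ k⌋ ≤ ⌊x * 2 ^ (k + 1)⌋ ∧ ⌊x * 2 ^ (k + 1)⌋ ≤ 2 * ⌊x * 2 ^ k⌋ + 1 := by
  have h1 := Int.floor_le (x * 2 ^ k)
  have h2 := Int.lt_floor_add_one (x * 2 ^ k)
  have e : x * 2 ^ (k + 1) = 2 * (x * 2 ^ k) := by ring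
  constructor
  · rw [Int.le_floor, e]
    push_cast
    linarith
  · rw [← Int.lt_add_one_iff, Int.floor_lt, e]
    push_cast
    linarith

/-- Near a fixed parameter, the differences at level `k` are of order `2⁻ᵏ`. -/
theorem exists_refineStep_iterate_abs_sub_le {m : ℕ} (hm : 1 ≤ m) (f : ℤ → ℝ) (x : ℝ) :
    ∃ M, ∀ k : ℕ, ∀ i : ℤ, ⌊x * 2 ^ k⌋ - (m + 1) ≤ i → i < ⌊x * 2 ^ k⌋ + (m + 1) →
      |(refineStep linearAverage m)^[k] f (i + 1) - (refineStep linearAverage m)^[k] f i| ≤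
        M / 2 ^ k := by
  obtain ⟨M, hM⟩ := ((finite_Ico (⌊x * 2 ^ 0⌋ - (m + 1) : ℤ) (⌊x * 2 ^ 0⌋ + (m + 1))).image
    fun i => |f (i + 1) - f i|).bddAbove
  refine ⟨M, fun k => ?_⟩
  induction k with
  | zero =>
    intro i hi hi'
    rw [pow_zero, div_one]
    exact hM ⟨i, ⟨hi, hi'⟩, rfl⟩
  | succ k ih =>
    intro i hi hi'
    obtain ⟨h1, h2⟩ := floor_mul_two_pow_succ x k
    rw [Function.iterate_succ_apply', pow_succ, ← div_div]
    -- The half-width `m + 1` reproduces itself: the window around the new floor, which is `2c` or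
    -- `2c + 1`, depends only on the window around the old floor `c`.
    exact refineStep_abs_sub_le hm ih (by omega) (by omega)

theorem abs_sub_le_of_succ {f : ℤ → ℝ} {M : ℝ} {a : ℤ} (d : ℕ)
    (h : ∀ i, a ≤ i → i < a + d → |f (i + 1) - f i| ≤ M) : |f (a + d) - f a| ≤ d * M := by
  induction d with
  | zero => simp
  | succ d ih =>
    have h1 := ih fun i hi hi' => h i hi (by push_cast; omega)
    have h2 := h (a + d) (by omega) (by push_cast; omega)
    have e : a + ((d + 1 : ℕ) : ℤ) = a + d + 1 := by push_cast; ring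
    rw [e]
    push_cast
    calc |f (a + d + 1) - f a| ≤ |f (a + d + 1) - f (a + d)| + |f (a + d) - f a| :=
          abs_sub_le _ _ _
      _ ≤ (d + 1) * M := by linarith

/-- Consecutive interpolants lie between two elements whose `μ`-values differ by `O(2⁻ᵏ)`. -/
theorem IsChainAverage.exists_interpolant_between {X : Type*} {avg : ℝ → X → X → X} {P : X → Prop}
    {r : X → X → Prop} {μ : X → ℝ} {F : ℤ → X} {m : ℕ} (h : IsChainAverage avg P r μ)
    (hF : IsIntChain P r F) (hm : 1 ≤ m) (x : ℝ) :
    ∃ M : ℝ, ∀ k : ℕ, ∃ lo hi : X, P lo ∧ P hi ∧ r lo hi ∧ |μ hi - μ lo| ≤ M / 2 ^ k ∧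
      (r lo (interpolant avg k ((refineStep avg m)^[k] F) x) ∧
        r (interpolant avg k ((refineStep avg m)^[k] F) x) hi) ∧
      (r lo (interpolant avg (k + 1) ((refineStep avg m)^[k + 1] F) x) ∧
        r (interpolant avg (k + 1) ((refineStep avg m)^[k + 1] F) x) hi) := by
  obtain ⟨M, hM⟩ := exists_refineStep_iterate_abs_sub_le hm (fun i => μ (F i)) x
  refine ⟨((2 * (m + 1) : ℕ) : ℝ) * M, fun k => ?_⟩
  have hk := h.isIntChain_refineStep_iterate (m := m) hF k
  have hk' := h.isIntChain_refineStep_iterate (m := m) hF (k + 1)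
  obtain ⟨-, hl, hu, -⟩ := h.interpolant_spec hk k x
  obtain ⟨-, hl', hu', -⟩ := h.interpolant_spec hk' (k + 1) x
  obtain ⟨h1, h2⟩ := floor_mul_two_pow_succ x k
  set c := ⌊x * 2 ^ k⌋
  set c' := ⌊x * 2 ^ (k + 1)⌋
  -- The bounds are the ends of the level-`k` window, `2 * (m + 1)` steps apart; the window also
  -- encloses the two level-`k + 1` elements used by the next interpolant.
  refine ⟨(refineStep avg m)^[k] F (c - (m + 1)),
    (refineStep avg m)^[k] F (c - (m + 1) + (2 * (m + 1) : ℕ)), hk.mem _, hk.mem _,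
    h.rel_of_le hk (by push_cast; omega), ?_, ⟨?_, ?_⟩, ?_, ?_⟩
  · rw [h.map_refineStep_iterate hF, h.map_refineStep_iterate hF, mul_div_assoc]
    exact abs_sub_le_of_succ _ fun i hi hi' => hM k i hi (by push_cast at hi'; omega)
  · exact h.trans (h.rel_of_le hk (by omega)) hl
  · exact h.trans hu (h.rel_of_le hk (by push_cast; omega))
  · refine h.trans ?_ hl'
    rw [Function.iterate_succ_apply']
    exact h.rel_refineStep hk (by omega)
  · refine h.trans hu' ?_
    rw [Function.iterate_succ_apply']
    exact h.refineStep_rel hk (by push_cast; omega)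

/-- At distinct parameters, the interpolants are eventually comparable. -/
theorem IsChainAverage.eventually_interpolant_rel {X : Type*} {avg : ℝ → X → X → X} {P : X → Prop}
    {r : X → X → Prop} {μ : X → ℝ} {F : ℤ → X} {m : ℕ} (h : IsChainAverage avg P r μ)
    (hF : IsIntChain P r F) {x y : ℝ} (hxy : x < y) :
    ∀ᶠ k : ℕ in atTop, r (interpolant avg k ((refineStep avg m)^[k] F) x)
      (interpolant avg k ((refineStep avg m)^[k] F) y) := by
  have hlim : Tendsto (fun k : ℕ => (y - x) * 2 ^ k) atTop atTop :=
    (tendsto_pow_atTop_atTop_of_one_lt one_lt_two).const_mul_atTop (sub_pos.2 hxy)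
  filter_upwards [hlim.eventually_ge_atTop 2] with k hk2
  have hk := h.isIntChain_refineStep_iterate (m := m) hF k
  refine h.trans (h.interpolant_spec hk k x).2.2.1
    (h.trans (h.rel_of_le hk ?_) (h.interpolant_spec hk k y).2.1)
  rw [Int.le_floor]
  push_cast
  linarith [Int.floor_le (x * 2 ^ k)]

/-! ### The spline mask -/

theorem splineMask_natCast (m k : ℕ) : splineMask m k = ((m + 1).choose k : ℝ) / 2 ^ m := by
  rw [splineMask]
  split_ifs with h
  · rw [Int.toNat_natCast]
  · rw [Nat.choose_eq_zero_of_lt (by omega), Nat.cast_zero, zero_div]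

theorem splineMask_of_neg (m : ℕ) {l : ℤ} (h : l < 0) : splineMask m l = 0 := by
  rw [splineMask, if_neg (by omega)]

/-- Pascal's rule, including the ends of the support: an averaging step raises the degree by one. -/
theorem splineMask_succ (m : ℕ) (l : ℤ) :
    splineMask (m + 1) (l + 1) = 1 / 2 * splineMask m l + (1 - 1 / 2) * splineMask m (l + 1) := by
  rcases lt_or_ge l 0 with h | h
  · rw [splineMask_of_neg m h]
    rcases eq_or_lt_of_le (show l + 1 ≤ 0 by omega) with h0 | h0
    · rw [h0]
      have e := splineMask_natCast (m + 1) 0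
      have e' := splineMask_natCast m 0
      rw [Nat.cast_zero] at e e'
      rw [e, e', Nat.choose_zero_right, Nat.choose_zero_right, pow_succ]
      field_simp
      ring
    · rw [splineMask_of_neg _ h0, splineMask_of_neg _ h0]
      ring
  · lift l to ℕ using h
    rw [← Nat.cast_succ, splineMask_natCast, splineMask_natCast, splineMask_natCast,
      Nat.choose_succ_succ, pow_succ]
    push_cast
    field_simp
    ring

theorem finite_support_splineMask_mul (m : ℕ) (l : ℤ) (f : ℤ → ℝ) :
    (Function.support fun j : ℤ => splineMask m (l - 2 * j) * f j).Finite := by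
  refine (finite_Icc ((l - m - 1) / 2) (l / 2)).subset fun j hj => ?_
  have h : splineMask m (l - 2 * j) ≠ 0 := left_ne_zero_of_mul hj
  rw [splineMask] at h
  have h' : 0 ≤ l - 2 * j ∧ l - 2 * j ≤ m + 1 := by
    by_contra hcon
    exact h (if_neg hcon)
  constructor <;> omega

theorem doublingStep_linearAverage (f : ℤ → ℝ) (i : ℤ) :
    doublingStep linearAverage f i = ∑ᶠ j : ℤ, splineMask 1 (1 + i - 2 * j) * f j := by
  have e0 : splineMask 1 0 = 1 / 2 := by norm_num [splineMask]
  have e1 : splineMask 1 1 = 1 := by norm_num [splineMask]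
  have e2 : splineMask 1 2 = 1 / 2 := by simpa using splineMask_natCast 1 2
  obtain ⟨c, hc⟩ := Int.even_or_odd' i
  rcases hc with hc | hc
  · rw [doublingStep_of_even c hc, finsum_eq_single _ c]
    · rw [show 1 + i - 2 * c = 1 by omega, e1, one_mul]
    · intro j hj
      rw [splineMask, if_neg (by push_cast; omega), zero_mul]
  · rw [doublingStep_of_odd c hc, finsum_eq_sum_of_support_subset _ (s := {c, c + 1}),
      Finset.sum_pair (by omega), show 1 + i - 2 * c = 2 by omega,
      show 1 + i - 2 * (c + 1) = 0 by omega, e0, e2, linearAverage]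
    · ring
    · intro j hj
      by_contra hcon
      simp only [Finset.coe_insert, Finset.coe_singleton, mem_insert_iff, mem_singleton_iff,
        not_or] at hcon
      refine hj ?_
      show splineMask 1 _ * f j = 0
      rw [splineMask, if_neg (by push_cast; omega), zero_mul]

theorem averagingStep_iterate_doublingStep (f : ℤ → ℝ) (k : ℕ) (i : ℤ) :
    (averagingStep linearAverage)^[k] (doublingStep linearAverage f) i =
      ∑ᶠ j : ℤ, splineMask (k + 1) (k + 1 + i - 2 * j) * f j := by
  induction k generalizing i with
  | zero =>
    rw [Function.iterate_zero, id_eq, doublingStep_linearAverage]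
    simp
  | succ k ih =>
    rw [Function.iterate_succ_apply', averagingStep, ih, ih, linearAverage]
    have h0 := finite_support_splineMask_mul (k + 1) (k + 1 + i) f
    have h1 := finite_support_splineMask_mul (k + 1) (k + 1 + (i + 1)) f
    rw [mul_finsum, mul_finsum]
    refine (finsum_add_distrib
      (h0.subset (Function.support_const_smul_subset (1 / 2 : ℝ) _))
      (h1.subset (Function.support_const_smul_subset (1 - 1 / 2 : ℝ) _))).symm.trans ?_
    refine finsum_congr fun j => ?_
    have e : ((k + 1 : ℕ) : ℤ) + 1 + i - 2 * j = (k + 1 + i - 2 * j) + 1 := by push_cast; ring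
    simp only [Pi.smul_apply, smul_eq_mul]
    rw [e, splineMask_succ, show (k : ℤ) + 1 + (i + 1) - 2 * j = k + 1 + i - 2 * j + 1 by ring]
    ring

/-- Matches the mask offset to the index shift of `refineStep`. -/
theorem ceil_half_succ {m : ℕ} (hm : 1 ≤ m) :
    ⌈((m : ℝ) + 1) / 2⌉ = (m : ℤ) - (((m - 1) / 2 : ℕ) : ℤ) := by
  obtain ⟨d, rfl⟩ : ∃ d, m = d + 1 := ⟨m - 1, by omega⟩
  rw [Int.ceil_eq_iff, Nat.add_sub_cancel]
  obtain ⟨c, hc | hc⟩ := Nat.even_or_odd' d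
  · rw [show d / 2 = c by omega, hc]
    push_cast
    constructor <;> linarith
  · rw [show d / 2 = c by omega, hc]
    push_cast
    constructor <;> linarith

/-- On real sequences, the Lane-Riesenfeld algorithm is the spline subdivision scheme. -/
theorem refineStep_linearAverage {m : ℕ} (hm : 1 ≤ m) (f : ℤ → ℝ) :
    refineStep linearAverage m f = realRefine m f := by
  funext i
  rw [refineStep, averagingStep_iterate_doublingStep, realRefine, ceil_half_succ hm]
  refine finsum_congr fun j => ?_
  rw [Nat.sub_add_cancel hm]
  congr 2
  omega

/-! ### Limits with respect to the symmetric difference -/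

/-- The limit is the set of points in infinitely many `E k`. A point on which `E k` and the limit
disagree must change membership at some later step, so the tails of the sum bound the distance. -/
theorem exists_measurableSet_tendsto_symmDiff {α : Type*} [MeasurableSpace α] {μ : Measure α}
    {E : ℕ → Set α} (hE : ∀ k, MeasurableSet (E k)) (hE0 : μ (E 0) ≠ ⊤)
    (hsum : ∑' k, μ (symmDiff (E k) (E (k + 1))) ≠ ⊤) :
    ∃ F, MeasurableSet F ∧ μ F ≠ ⊤ ∧ Tendsto (fun k => μ (symmDiff (E k) F)) atTop (𝓝 0) := by
  set F : Set α := ⋂ i, ⋃ j, E (i + j) with hF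
  have hsub : ∀ k, symmDiff (E k) F ⊆ ⋃ j, symmDiff (E (j + k)) (E (j + k + 1)) := by
    intro k p hp
    by_contra hcon
    simp only [mem_iUnion, not_exists] at hcon
    have hstep : ∀ j, p ∈ E (k + j) ↔ p ∈ E k := by
      intro j
      induction j with
      | zero => rfl
      | succ j ih =>
        have := hcon j
        rw [mem_symmDiff, add_comm j k] at this
        rw [← ih, ← add_assoc]
        tauto
    have hpF : p ∈ F ↔ p ∈ E k := by
      simp only [hF, mem_iInter, mem_iUnion]
      constructor
      · intro h
        obtain ⟨j, hj⟩ := h k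
        exact (hstep j).1 hj
      · intro h i
        exact ⟨k, by rw [add_comm]; exact (hstep i).2 h⟩
    rw [mem_symmDiff, hpF] at hp
    tauto
  have hle : ∀ k, μ (symmDiff (E k) F) ≤ ∑' j, μ (symmDiff (E (j + k)) (E (j + k + 1))) :=
    fun k => (measure_mono (hsub k)).trans (measure_iUnion_le _)
  refine ⟨F, MeasurableSet.iInter fun i => MeasurableSet.iUnion fun j => hE _, ?_, ?_⟩
  · have h1 : F ⊆ E 0 ∪ symmDiff (E 0) F := fun p hp => by
      by_cases h : p ∈ E 0
      · exact Or.inl h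
      · exact Or.inr (Or.inr ⟨hp, h⟩)
    refine ne_top_of_le_ne_top (ENNReal.add_ne_top.2 ⟨hE0, ?_⟩)
      ((measure_mono h1).trans (measure_union_le _ _))
    exact ne_top_of_le_ne_top hsum (hle 0)
  · exact tendsto_of_tendsto_of_tendsto_of_le_of_le tendsto_const_nhds
      (ENNReal.tendsto_sum_nat_add _ hsum) (fun _ => zero_le) hle

section
variable {n : ℕ} {A B : Set (EuclideanSpace ℝ (Fin n))}

theorem symmDiffDist_comm (A B : Set (EuclideanSpace ℝ (Fin n))) :
    symmDiffDist A B = symmDiffDist B A := by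
  rw [symmDiffDist, symmDiff_comm, symmDiffDist]

theorem symmDiffDist_triangle {A B : Set (EuclideanSpace ℝ (Fin n))} (hA : volume A ≠ ⊤)
    (hB : volume B ≠ ⊤) (C : Set (EuclideanSpace ℝ (Fin n))) :
    symmDiffDist A C ≤ symmDiffDist A B + symmDiffDist B C :=
  measureReal_symmDiff_le C hA hB

theorem abs_volume_sub_le_symmDiffDist (hA : volume A ≠ ⊤) (hB : volume B ≠ ⊤) :
    |volume.real A - volume.real B| ≤ symmDiffDist A B := by
  have key : ∀ {A B : Set (EuclideanSpace ℝ (Fin n))}, volume A ≠ ⊤ → volume B ≠ ⊤ →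
      volume.real A - volume.real B ≤ symmDiffDist A B := fun {A B} hA hB => by
    have h1 : A ⊆ B ∪ symmDiff A B := fun p hp => by
      by_cases h : p ∈ B
      · exact Or.inl h
      · exact Or.inr (Or.inl ⟨hp, h⟩)
    have hfin : volume (B ∪ symmDiff A B) ≠ ⊤ :=
      measure_ne_top_of_subset (union_subset subset_union_right symmDiff_subset_union)
        (measure_union_ne_top hA hB)
    have := (measureReal_mono h1 hfin).trans (measureReal_union_le _ _)
    rw [symmDiffDist]
    linarith
  rw [abs_le]
  have h2 := key hB hA
  rw [symmDiffDist_comm] at h2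
  constructor
  · linarith
  · exact key hA hB

theorem symmDiffDist_of_nested (hA : IsRegularJordan A) (hB : IsRegularJordan B)
    (h : A ⊆ B ∨ B ⊆ A) : symmDiffDist A B = |volume.real A - volume.real B| := by
  have key : ∀ {A B : Set (EuclideanSpace ℝ (Fin n))}, IsRegularJordan A → IsRegularJordan B →
      A ⊆ B → symmDiffDist A B = |volume.real A - volume.real B| := fun {A B} hA hB h => by
    rw [symmDiffDist, symmDiff_of_le h, measureReal_sdiff h hA.isClosed.measurableSet
      hB.volume_ne_top, abs_sub_comm, abs_of_nonneg
      (sub_nonneg.2 (measureReal_mono h hB.volume_ne_top))]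
  rcases h with h | h
  · exact key hA hB h
  · rw [symmDiffDist_comm, key hB hA h, abs_sub_comm]

theorem tendsto_volume_of_tendsto_symmDiffDist {E : ℕ → Set (EuclideanSpace ℝ (Fin n))}
    {F : Set (EuclideanSpace ℝ (Fin n))} (hE : ∀ k, volume (E k) ≠ ⊤) (hF : volume F ≠ ⊤)
    (h : Tendsto (fun k => symmDiffDist (E k) F) atTop (𝓝 0)) :
    Tendsto (fun k => volume.real (E k)) atTop (𝓝 (volume.real F)) := by
  rw [tendsto_iff_dist_tendsto_zero]
  exact squeeze_zero (fun _ => dist_nonneg)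
    (fun k => abs_volume_sub_le_symmDiffDist (hE k) hF) h

theorem tendsto_symmDiffDist {E E' : ℕ → Set (EuclideanSpace ℝ (Fin n))}
    {F F' : Set (EuclideanSpace ℝ (Fin n))} (hE : ∀ k, volume (E k) ≠ ⊤) (hF : volume F ≠ ⊤)
    (hE' : ∀ k, volume (E' k) ≠ ⊤) (hF' : volume F' ≠ ⊤)
    (h : Tendsto (fun k => symmDiffDist (E k) F) atTop (𝓝 0))
    (h' : Tendsto (fun k => symmDiffDist (E' k) F') atTop (𝓝 0)) :
    Tendsto (fun k => symmDiffDist (E k) (E' k)) atTop (𝓝 (symmDiffDist F F')) := by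
  rw [tendsto_iff_dist_tendsto_zero]
  refine squeeze_zero (fun _ => dist_nonneg) (fun k => ?_) (by simpa using h.add h')
  rw [Real.dist_eq, abs_le]
  have h1 := symmDiffDist_triangle (hE k) hF (E' k)
  have h2 := symmDiffDist_triangle hF hF' (E' k)
  have h3 := symmDiffDist_triangle hF (hE k) F'
  have h4 := symmDiffDist_triangle (hE k) (hE' k) F'
  rw [symmDiffDist_comm F' (E' k)] at h2
  rw [symmDiffDist_comm F (E k)] at h3
  constructor <;> linarith

/-! ### Set-valued spline subdivision of nested sets -/

theorem isChainAverage_measureAverage_subset (hn : 1 ≤ n) {N : ℝ} (hN : 1 ≤ N) {ε : ℝ}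
    (hε : 0 < ε) {q : Set (EuclideanSpace ℝ (Fin n)) → EuclideanSpace ℝ (Fin n)}
    (hq : IsCenterChoice q) :
    IsChainAverage (measureAverage N ε q) IsRegularJordan (fun A B => A ⊆ B) volume.real where
  refl _ := Subset.rfl
  trans := Subset.trans
  mem ht hA hB h := (measureAverage_spec hn hN hε hq hA hB (Or.inl h) ht).1
  left ht hA hB h := (subset_inter Subset.rfl h).trans
    (measureAverage_spec hn hN hε hq hA hB (Or.inl h) ht).2.1
  right ht hA hB h := (measureAverage_spec hn hN hε hq hA hB (Or.inl h) ht).2.2.1.trans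
    (union_subset h Subset.rfl)
  map ht hA hB h := (measureAverage_spec hn hN hε hq hA hB (Or.inl h) ht).2.2.2

theorem isChainAverage_measureAverage_superset (hn : 1 ≤ n) {N : ℝ} (hN : 1 ≤ N) {ε : ℝ}
    (hε : 0 < ε) {q : Set (EuclideanSpace ℝ (Fin n)) → EuclideanSpace ℝ (Fin n)}
    (hq : IsCenterChoice q) :
    IsChainAverage (measureAverage N ε q) IsRegularJordan (fun A B => B ⊆ A) volume.real where
  refl _ := Subset.rfl
  trans h h' := Subset.trans h' h
  mem ht hA hB h := (measureAverage_spec hn hN hε hq hA hB (Or.inr h) ht).1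
  left ht hA hB h := (measureAverage_spec hn hN hε hq hA hB (Or.inr h) ht).2.2.1.trans
    (union_subset Subset.rfl h)
  right ht hA hB h := (subset_inter h Subset.rfl).trans
    (measureAverage_spec hn hN hε hq hA hB (Or.inr h) ht).2.1
  map ht hA hB h := (measureAverage_spec hn hN hε hq hA hB (Or.inr h) ht).2.2.2

section
variable {N ε : ℝ} {q : Set (EuclideanSpace ℝ (Fin n)) → EuclideanSpace ℝ (Fin n)} {m : ℕ}
  {r : Set (EuclideanSpace ℝ (Fin n)) → Set (EuclideanSpace ℝ (Fin n)) → Prop}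
  {F₀ : ℤ → Set (EuclideanSpace ℝ (Fin n))}

/-- Taking measures commutes with the whole scheme; this is the bridge to the real-valued scheme. -/
theorem interpolant_realRefine (h : IsChainAverage (measureAverage N ε q) IsRegularJordan r
      volume.real) (hF₀ : IsIntChain IsRegularJordan r F₀) (hm : 1 ≤ m) (k : ℕ) (x : ℝ) :
    interpolant (fun t a b : ℝ => t * a + (1 - t) * b) k
        ((realRefine m)^[k] fun i => volume.real (F₀ i)) x =
      volume.real (interpolant (measureAverage N ε q) k
        ((refineStep (measureAverage N ε q) m)^[k] F₀) x) := by
  rw [(h.interpolant_spec (h.isIntChain_refineStep_iterate hF₀ k) k x).2.2.2,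
    funext (h.map_refineStep_iterate hF₀ k), funext (refineStep_linearAverage hm)]

/-- Consecutive interpolants both lie between `lo` and `hi`, so they differ only inside `lo Δ hi`,
of measure `O(2⁻ᵏ)`, which is summable. Comparability `hr` and betweenness `hr'` cover increasing
and decreasing chains at once. -/
theorem exists_isSetSplineLimit (h : IsChainAverage (measureAverage N ε q) IsRegularJordan r
      volume.real) (hF₀ : IsIntChain IsRegularJordan r F₀) (hm : 1 ≤ m)
    (hr : ∀ A B, r A B → A ⊆ B ∨ B ⊆ A)
    (hr' : ∀ A B C, r A B → r B C → A ∩ C ⊆ B ∧ B ⊆ A ∪ C) :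
    ∃ F, IsSetSplineLimit N ε q m F₀ F := by
  choose F hF using fun x : ℝ => show ∃ F : Set (EuclideanSpace ℝ (Fin n)),
      NullMeasurableSet F volume ∧ volume F < ⊤ ∧ Tendsto (fun k : ℕ => symmDiffDist
        (interpolant (measureAverage N ε q) k ((refineStep (measureAverage N ε q) m)^[k] F₀) x)
        F) atTop (𝓝 0) by
    have hE : ∀ k, IsRegularJordan (interpolant (measureAverage N ε q) k
        ((refineStep (measureAverage N ε q) m)^[k] F₀) x) := fun k =>
      (h.interpolant_spec (h.isIntChain_refineStep_iterate hF₀ k) k x).1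
    obtain ⟨M, hM⟩ := h.exists_interpolant_between hF₀ hm x
    set E : ℕ → Set (EuclideanSpace ℝ (Fin n)) := fun k => interpolant (measureAverage N ε q) k
        ((refineStep (measureAverage N ε q) m)^[k] F₀) x with hEdef
    have hfin : ∀ k, volume (symmDiff (E k) (E (k + 1))) ≠ ⊤ := fun k =>
      measure_ne_top_of_subset symmDiff_subset_union
        (measure_union_ne_top (hE k).volume_ne_top (hE (k + 1)).volume_ne_top)
    have hbound : ∀ k, symmDiffDist (E k) (E (k + 1)) ≤ M / 2 ^ k := by
      intro k
      obtain ⟨lo, hi, hlo, hhi, hlohi, hle, ⟨h1, h2⟩, h3, h4⟩ := hM k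
      refine le_trans ?_ hle
      rw [abs_sub_comm, ← symmDiffDist_of_nested hlo hhi (hr _ _ hlohi)]
      refine measureReal_mono ?_ (measure_ne_top_of_subset symmDiff_subset_union
        (measure_union_ne_top hlo.volume_ne_top hhi.volume_ne_top))
      obtain ⟨a1, a2⟩ := hr' _ _ _ h1 h2
      obtain ⟨b1, b2⟩ := hr' _ _ _ h3 h4
      rintro p (⟨hp, hp'⟩ | ⟨hp, hp'⟩)
      · rcases a2 hp with h | h
        · exact Or.inl ⟨h, fun h' => hp' (b1 ⟨h, h'⟩)⟩
        · exact Or.inr ⟨h, fun h' => hp' (b1 ⟨h', h⟩)⟩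
      · rcases b2 hp with h | h
        · exact Or.inl ⟨h, fun h' => hp' (a1 ⟨h, h'⟩)⟩
        · exact Or.inr ⟨h, fun h' => hp' (a1 ⟨h', h⟩)⟩
    have hsummable : Summable fun k : ℕ => M / 2 ^ k := by
      simpa [div_eq_mul_inv] using
        (summable_geometric_of_lt_one (r := (2 : ℝ)⁻¹) (by norm_num) (by norm_num)).mul_left M
    have hsum : ∑' k, volume (symmDiff (E k) (E (k + 1))) ≠ ⊤ := by
      refine ne_top_of_le_ne_top hsummable.tsum_ofReal_ne_top (ENNReal.tsum_le_tsum fun k => ?_)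
      rw [← ENNReal.ofReal_toReal (hfin k)]
      exact ENNReal.ofReal_le_ofReal (hbound k)
    obtain ⟨F, hFm, hFfin, hF⟩ := exists_measurableSet_tendsto_symmDiff
      (fun k => (hE k).isClosed.measurableSet) (hE 0).volume_ne_top hsum
    refine ⟨F, hFm.nullMeasurableSet, hFfin.lt_top, ?_⟩
    have := (ENNReal.tendsto_toReal ENNReal.zero_ne_top).comp hF
    rwa [ENNReal.toReal_zero] at this
  exact ⟨F, hF⟩

/-- At distinct parameters the interpolants are eventually nested, so the identity holds at level
`k` and passes to the limit. -/
theorem symmDiffDist_eq_abs_sub (h : IsChainAverage (measureAverage N ε q) IsRegularJordan r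
      volume.real) (hF₀ : IsIntChain IsRegularJordan r F₀) (hm : 1 ≤ m)
    (hr : ∀ A B, r A B → A ⊆ B ∨ B ⊆ A) {F : ℝ → Set (EuclideanSpace ℝ (Fin n))} {f : ℝ → ℝ}
    (hF : IsSetSplineLimit N ε q m F₀ F)
    (hf : IsRealSplineLimit m (fun i => volume.real (F₀ i)) f) (x y : ℝ) :
    symmDiffDist (F x) (F y) = |f x - f y| := by
  have key : ∀ {x y : ℝ}, x < y → symmDiffDist (F x) (F y) = |f x - f y| := by
    intro x y hxy
    have hE : ∀ x k, IsRegularJordan (interpolant (measureAverage N ε q) k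
        ((refineStep (measureAverage N ε q) m)^[k] F₀) x) := fun x k =>
      (h.interpolant_spec (h.isIntChain_refineStep_iterate hF₀ k) k x).1
    have h1 := tendsto_symmDiffDist (fun k => (hE x k).volume_ne_top) (hF x).2.1.ne
      (fun k => (hE y k).volume_ne_top) (hF y).2.1.ne (hF x).2.2 (hF y).2.2
    refine tendsto_nhds_unique_of_eventuallyEq h1 ((hf x).sub (hf y)).abs ?_
    filter_upwards [h.eventually_interpolant_rel (m := m) hF₀ hxy] with k hk
    rw [interpolant_realRefine h hF₀ hm, interpolant_realRefine h hF₀ hm]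
    exact symmDiffDist_of_nested (hE x k) (hE y k) (hr _ _ hk)
  rcases lt_trichotomy x y with hxy | rfl | hxy
  · exact key hxy
  · simp [symmDiffDist]
  · rw [symmDiffDist_comm, key hxy, abs_sub_comm]

theorem isRealSplineLimit_volume (h : IsChainAverage (measureAverage N ε q) IsRegularJordan r
      volume.real) (hF₀ : IsIntChain IsRegularJordan r F₀) (hm : 1 ≤ m)
    {F : ℝ → Set (EuclideanSpace ℝ (Fin n))} (hF : IsSetSplineLimit N ε q m F₀ F) :
    IsRealSplineLimit m (fun i => volume.real (F₀ i)) fun x => volume.real (F x) := by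
  intro x
  simp only [interpolant_realRefine h hF₀ hm]
  exact tendsto_volume_of_tendsto_symmDiffDist
    (fun k => (h.interpolant_spec (h.isIntChain_refineStep_iterate hF₀ k) k x).1.volume_ne_top)
    (hF x).2.1.ne (hF x).2.2

end
end

/-! ### Equality of the speeds -/

theorem HasDerivAt.hasSpeedAt {f : ℝ → ℝ} {f' x : ℝ} (h : HasDerivAt f f' x) :
    HasSpeedAt (fun a b : ℝ => |a - b|) f x |f'| := by
  refine (h.tendsto_slope_zero.abs).congr fun δ => ?_
  rw [smul_eq_mul, abs_mul, abs_inv, abs_sub_comm, div_eq_inv_mul]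

theorem corollary5p7 (n : ℕ) (hn : 1 ≤ n) (m : ℕ) (hm : 1 ≤ m)
    (N : ℝ) (hN : 1 ≤ N) (ε : ℝ) (hε : 0 < ε)
    (q : Set (EuclideanSpace ℝ (Fin n)) → EuclideanSpace ℝ (Fin n)) (hq : IsCenterChoice q)
    (F₀ : ℤ → Set (EuclideanSpace ℝ (Fin n))) (hF₀ : ∀ i, IsRegularJordan (F₀ i))
    (hmono : Monotone F₀ ∨ Antitone F₀) :
    (∃ F, IsSetSplineLimit N ε q m F₀ F) ∧
    (∃ f, IsRealSplineLimit m (fun i => volume.real (F₀ i)) f) ∧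
    ∀ (F : ℝ → Set (EuclideanSpace ℝ (Fin n))) (f : ℝ → ℝ),
      IsSetSplineLimit N ε q m F₀ F →
      IsRealSplineLimit m (fun i => volume.real (F₀ i)) f →
      ∀ x : ℝ,
        (∀ v : ℝ, HasSpeedAt symmDiffDist F x v ↔ HasSpeedAt (fun a b : ℝ => |a - b|) f x v) ∧
        (∀ f' : ℝ, HasDerivAt f f' x → HasSpeedAt symmDiffDist F x |f'|) := by
  obtain ⟨r, h, hF, hr, hr'⟩ : ∃ r, IsChainAverage (measureAverage N ε q) IsRegularJordan r
      volume.real ∧ IsIntChain IsRegularJordan r F₀ ∧ (∀ A B, r A B → A ⊆ B ∨ B ⊆ A) ∧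
      ∀ A B C, r A B → r B C → A ∩ C ⊆ B ∧ B ⊆ A ∪ C := by
    rcases hmono with hmono | hmono
    · exact ⟨_, isChainAverage_measureAverage_subset hn hN hε hq,
        ⟨hF₀, fun i => hmono (by omega)⟩, fun _ _ => Or.inl, fun _ _ _ h h' =>
        ⟨inter_subset_left.trans h, h'.trans subset_union_right⟩⟩
    · exact ⟨_, isChainAverage_measureAverage_superset hn hN hε hq,
        ⟨hF₀, fun i => hmono (by omega)⟩, fun _ _ => Or.inr, fun _ _ _ h h' =>
        ⟨inter_subset_right.trans h', h.trans subset_union_left⟩⟩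
  obtain ⟨F', hF'⟩ := exists_isSetSplineLimit h hF hm hr hr'
  refine ⟨⟨F', hF'⟩, ⟨_, isRealSplineLimit_volume h hF hm hF'⟩, fun F f hFl hfl x => ?_⟩
  have hiff : ∀ v : ℝ, HasSpeedAt symmDiffDist F x v ↔
      HasSpeedAt (fun a b : ℝ => |a - b|) f x v := fun v => by
    unfold HasSpeedAt
    simp only [symmDiffDist_eq_abs_sub h hF hm hr hFl hfl]
  exact ⟨hiff, fun f' hf' => (hiff _).2 hf'.hasSpeedAt⟩
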